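/- Conventions. A semifield is a finite, not necessarily associative, unital ring $\mathbb S$ without zero divisors; its multiplication is written $(x,y)\mapsto\mathbb S(x,y)$. Its centre, the set of elements that commute and associate with all elements, is a finite field. For a field $\mathbb F_q$ contained in the centre, $\dim_{\mathbb F_q}\mathbb S=n$, let $\mathcal S_q(\mathbb S)$ be the semifield spread of the $2n$-dimensional $\mathbb F_q$-space $\mathbb S\times\mathbb S$ that consists of the subspaces $S_x=\{(y,\mathbb S(x,y)):y\in\mathbb S\}$ $(x\in\mathbb S)$ and $S_\infty=\{(0,y):y\in\mathbb S\}$. Two sets of subspaces are equivalent ($\simeq$) if an invertible semilinear map takes one to the other. A Desarguesian $n$-spread of an $\mathbb F_q$-vector space $V$ is the set of all one-dimensional $\mathbb F_{q^n}$-subspaces of $V$, for some $\mathbb F_{q^n}$-vector space structure on $V$ that extends the given $\mathbb F_q$-structure. A BEL-configuration in $V(rn,q)$ is a triple $(\mathcal D,U,W)$, where $\mathcal D$ is a Desarguesian $n$-spread, $U$ and $W$ are subspaces with $\dim U=n$ and $\dim W=rn-n$, and no element of $\mathcal D$ meets both $U$ and $W$ nontrivially. It defines a semifield spread $\mathcal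 S(\mathcal D,U,W)$ of $V(rn+n,q)/W$, up to equivalence: embed $V(rn,q)$ in $V(rn+n,q)$, extend $\mathcal D$ to a Desarguesian $n$-spread $\mathcal D'$ of $V(rn+n,q)$, choose an $(n+1)$-dimensional subspace $A$ with $A\cap V(rn,q)=U$, and take all $\langle X,W\rangle/W$ with $X\in\mathcal D'$, $X\cap A\neq 0$. The BEL-rank of a semifield spread $\mathcal S$ of a $2n$-dimensional $\mathbb F_q$-space is the minimum $r$ such that $\mathcal S\simeq\mathcal S(\mathcal D,U,W)$ for some BEL-configuration in $V(rn,q)$. The BEL-rank $\mathrm{brk}(\mathbb S)$ of a semifield is the BEL-rank of $\mathcal S_{q_0}(\mathbb S)$, where $\mathbb F_{q_0}$ is the full centre of $\mathbb S$. Now let $\mathbb S$ be a semifield of order $q^n$ whose centre contains $\mathbb F_q$, and identify its underlying $\mathbb F_q$-vector space with $\mathbb F_{q^n}$. Let $E=\mathrm{End}_{\mathbb F_q}(\mathbb F_{q^n})$, and let $L(\mathbb S)=\{L_y:y\in\mathbb F_{q^n}\}\subseteq E$, where $L_y(x)=\mathbb S(y,x)$. Semifields $\mathbb S,\mathbb S'$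 on $\mathbb F_{q^n}$ whose multiplications are $\mathbb F_q$-bilinear are isotopic ($\mathbb S'\simeq\mathbb S$) if there are invertible $\mathbb F_q$-linear maps $P,Q,H$ with $\mathbb S'(P(x),Q(y))=H(\mathbb S(x,y))$ for all $x,y$. Let $\mathcal D_r$ be the Desarguesian spread of $E$ formed by the spaces $\{f\alpha:\alpha\in\mathbb F_{q^n}\}$, $0\neq f\in E$, where $(f\alpha)(x)=f(\alpha x)$. Let $\mathcal F_r\subset\mathcal D_r$ be the family of those maximal subspaces of the Segre variety of rank one endomorphisms that are of the form $\{f\in E:\mathrm{im} f\subseteq\langle c\rangle_{\mathbb F_q}\}$, $c\neq0$. For a spread $\mathcal D$ of $E$ and a subspace $L$ of $E$, let $B_{\mathcal D}(L)$ be the set of elements of $\mathcal D$ that contain a nonzero vector of $L$. **Theorem.** With this notation, $$\mathrm{brk}(\mathbb S)=\frac1n\min\{\dim_{\mathbb F_q}\langle B_{\mathcal D_r}(L(\mathbb S'))\rangle:\mathbb S'\simeq\mathbb S\}=\frac1n\min\{\dim_{\mathbb F_q}\langle B_{\mathcal D}(L(\mathbb S))\rangle:\mathcal D\text{ a Desarguesian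 }n\text{-spread of }E,\ \mathcal F_r\subset\mathcal D\}.$$ -/

import Mathlib

noncomputable section

namespace BEL

/-! ### Desarguesian spreads -/

/-- A Desarguesian `n`-spread of the `k`-vector space `V`: for some field `A` of degree `n` over `k`
and some structure of `A`-vector space on `V` extending the structure of `k`-vector space, it is
the set of all one-dimensional `A`-subspaces. The field `A` is given here by its action
on `V`, that is, as a `k`-subalgebra of `End_k(V)`. -/
def IsDesarguesianSpread (k V : Type*) [Field k] [AddCommGroup V] [Module k V] (n : ℕ)
    (D : Set (Submodule k V)) : Prop :=
  ∃ A : Subalgebra k (Module.End k V), IsField A ∧ Module.finrank k A = n ∧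
    D = {X : Submodule k V | ∃ v : V, v ≠ 0 ∧ (X : Set V) = {w | ∃ a ∈ A, a v = w}}

/-- Two sets of subspaces (of vector spaces over the same field `k`) are equivalent if an
invertible semilinear map takes one to the other. -/
def SpreadEquiv {k V V' : Type*} [Field k] [AddCommGroup V] [Module k V] [AddCommGroup V']
    [Module k V'] (𝒮 : Set (Submodule k V)) (𝒮' : Set (Submodule k V')) : Prop :=
  ∃ (σ : k ≃+* k) (φ : V ≃+ V'), (∀ (c : k) (v : V), φ (c • v) = σ c • φ v) ∧
    (fun X : Submodule k V => φ '' (X : Set V)) '' 𝒮 =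
      (fun Y : Submodule k V' => (Y : Set V')) '' 𝒮'

/-! ### BEL-configurations, and the spreads that they define -/

/-- `(D, U, W)` is a BEL-configuration in `V(rn, k) = k^{rn}`. -/
structure IsBELConfiguration (k : Type*) [Field k] (n r : ℕ)
    (D : Set (Submodule k (Fin (r * n) → k))) (U W : Submodule k (Fin (r * n) → k)) : Prop where
  desarguesian : IsDesarguesianSpread k (Fin (r * n) → k) n D
  finrank_U : Module.finrank k U = n
  finrank_W : Module.finrank k W + n = r * n
  not_both : ∀ X ∈ D, ¬ (X ⊓ U ≠ ⊥ ∧ X ⊓ W ≠ ⊥)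

/-- `V(rn, k) ⊕ k^n`, a vector space of dimension `rn + n` containing `V(rn, k)`. -/
abbrev Ambient (k : Type*) (n r : ℕ) : Type _ := (Fin (r * n) → k) × (Fin n → k)

/-- A subspace of `V(rn, k)`, as a subspace of `V(rn + n, k)`. -/
abbrev embed {k : Type*} [Field k] {n r : ℕ} (X : Submodule k (Fin (r * n) → k)) :
    Submodule k (Ambient k n r) :=
  X.map (LinearMap.inl k (Fin (r * n) → k) (Fin n → k))

/-- `𝒮` is a spread `𝒮(D, U, W)` of `V(rn + n, k) / W`, given by the construction of Ball, Ebert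
and Lavrauw: extend `D` to a Desarguesian `n`-spread `D'` of `V(rn + n, k)`, take a subspace `A` of
dimension `n + 1` that meets `V(rn, k)` in `U`, and let `𝒮` consist of the spaces `⟨X, W⟩ / W`,
where `X` runs over the elements of `D'` that meet `A` nontrivially. (The choices of `D'` and `A` do
not change the equivalence class of `𝒮`.) -/
def IsBELSpread (k : Type*) [Field k] (n r : ℕ)
    (D : Set (Submodule k (Fin (r * n) → k))) (U W : Submodule k (Fin (r * n) → k))
    (𝒮 : Set (Submodule k (Ambient k n r ⧸ (embed W : Submodule k (Ambient k n r))))) : Prop :=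
  ∃ (D' : Set (Submodule k (Ambient k n r))) (A : Submodule k (Ambient k n r)),
    IsDesarguesianSpread k (Ambient k n r) n D' ∧
    (∀ X ∈ D, embed X ∈ D') ∧
    Module.finrank k A = n + 1 ∧
    A ⊓ embed ⊤ = embed U ∧
    𝒮 = {Y | ∃ X ∈ D', X ⊓ A ≠ ⊥ ∧ Y = X.map (embed W : Submodule k (Ambient k n r)).mkQ}

/-- The BEL-rank of a set `𝒮` of subspaces of a `2n`-dimensional vector space (for us, a semifield
spread): the minimum `r` such that `𝒮` is equivalent to `𝒮(D, U, W)` for some BEL-configuration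
`(D, U, W)` in `V(rn, k)`. -/
def spreadBELRank {k V : Type*} [Field k] [AddCommGroup V] [Module k V] (n : ℕ)
    (𝒮 : Set (Submodule k V)) : ℕ :=
  sInf {r : ℕ | ∃ (D : Set (Submodule k (Fin (r * n) → k))) (U W : Submodule k (Fin (r * n) → k)),
    IsBELConfiguration k n r D U W ∧ ∃ 𝒯, IsBELSpread k n r D U W 𝒯 ∧ SpreadEquiv 𝒯 𝒮}

/-! ### Semifields: finite nonassociative unital rings without zero divisors -/

section Rings

variable (R : Type*) [NonAssocRing R]

/-- The commutative ring structure of the centre (all elements that commute and associate with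
everything). -/
abbrev centreCommRing : CommRing (Subring.center R) :=
  { (inferInstance : NonAssocRing (Subring.center R)) with
    mul_comm := fun a b => Subtype.ext (a.2.comm b.1)
    mul_assoc := fun a b c => Subtype.ext (a.2.left_assoc b.1 c.1).symm }

theorem centre_isField [Finite R] [Nontrivial R] [NoZeroDivisors R] :
    letI := centreCommRing R
    IsField (Subring.center R) := by
  let _ := centreCommRing R
  have : Nontrivial (Subring.center R) :=
    ⟨0, 1, fun h => zero_ne_one (α := R) (congrArg Subtype.val h)⟩
  have : NoZeroDivisors (Subring.center R) := ⟨fun {a b} h => by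
    have h' : a.1 * b.1 = 0 := congrArg Subtype.val h
    rcases mul_eq_zero.mp h' with h' | h'
    · exact Or.inl (Subtype.ext h')
    · exact Or.inr (Subtype.ext h')⟩
  have : IsDomain (Subring.center R) := NoZeroDivisors.to_isDomain _
  exact Finite.isField_of_domain (Subring.center R)

/-- The centre of a semifield is a field. -/
abbrev centreField [Finite R] [Nontrivial R] [NoZeroDivisors R] : Field (Subring.center R) :=
  letI := centreCommRing R
  (centre_isField R).toField

/-- A semifield is a vector space over its centre. -/
abbrev centreModule [Finite R] [Nontrivial R] [NoZeroDivisors R] :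
    letI := centreField R
    Module (Subring.center R) R :=
  letI := centreField R
  { smul := fun c x => c.1 * x
    one_smul := fun x => _root_.one_mul x
    mul_smul := fun a b x => (a.2.left_assoc b.1 x).symm
    smul_zero := fun a => mul_zero a.1
    smul_add := fun a x y => mul_add a.1 x y
    add_smul := fun a b x => add_mul a.1 b.1 x
    zero_smul := fun x => zero_mul x }

end Rings

/-- The semifield spread of `R`, in the vector space `R × R` over a field `k` contained in the
centre: the subspaces `S_x = {(y, x y) : y ∈ R}`, for `x` in `R`, and `S_∞ = {(0, y) : y ∈ R}`. -/
def semifieldSpread (k R : Type*) [Field k] [NonAssocRing R] [Module k R] :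
    Set (Submodule k (R × R)) :=
  {X : Submodule k (R × R) | (∃ x : R, (X : Set (R × R)) = {p | p.2 = x * p.1}) ∨
    (X : Set (R × R)) = {p | p.1 = 0}}

/-- The BEL-rank of a semifield `R`: the BEL-rank of its spread over its centre. -/
def belRank (R : Type*) [NonAssocRing R] [Finite R] [Nontrivial R] [NoZeroDivisors R] : ℕ :=
  letI := centreField R
  letI := centreModule R
  spreadBELRank (Module.finrank (Subring.center R) R) (semifieldSpread (Subring.center R) R)

/-! ### Semifields on the vector space `K = 𝔽_{q^n}` over `F = 𝔽_q` -/

/-- A semifield whose underlying `F`-vector space is that of the field `K`. Since the multiplication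
is `F`-bilinear, the centre contains (a copy of) `F`. -/
structure SemifieldOn (F K : Type*) [Field F] [Field K] [Algebra F K] where
  mul : K →ₗ[F] K →ₗ[F] K
  one : K
  one_mul : ∀ x, mul one x = x
  mul_one : ∀ x, mul x one = x
  eq_zero_or_eq_zero : ∀ x y, mul x y = 0 → x = 0 ∨ y = 0

namespace SemifieldOn

variable {F K : Type*} [Field F] [Field K] [Algebra F K]

/-- The set `K`, as the underlying set of the ring with the multiplication of `S`. -/
def Carrier (_S : SemifieldOn F K) : Type _ := K

instance (S : SemifieldOn F K) : AddCommGroup S.Carrier := inferInstanceAs (AddCommGroup K)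

instance (S : SemifieldOn F K) : NonAssocRing S.Carrier :=
  { (inferInstance : AddCommGroup S.Carrier) with
    mul := fun x y => S.mul x y
    one := S.one
    left_distrib := fun x y z => (S.mul x).map_add y z
    right_distrib := fun x y z => LinearMap.congr_fun (S.mul.map_add x y) z
    zero_mul := fun x => LinearMap.congr_fun S.mul.map_zero x
    mul_zero := fun x => (S.mul x).map_zero
    one_mul := S.one_mul
    mul_one := S.mul_one }

instance (S : SemifieldOn F K) [Finite K] : Finite S.Carrier := inferInstanceAs (Finite K)

instance (S : SemifieldOn F K) : Nontrivial S.Carrier := inferInstanceAs (Nontrivial K)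

instance (S : SemifieldOn F K) : NoZeroDivisors S.Carrier :=
  ⟨fun {x y} h => S.eq_zero_or_eq_zero x y h⟩

/-- Isotopism: `S'(P x, Q y) = H (S(x, y))` for nonsingular linear maps `P, Q, H`. -/
def Isotopic (S S' : SemifieldOn F K) : Prop :=
  ∃ P Q H : K ≃ₗ[F] K, ∀ x y, S'.mul (P x) (Q y) = H (S.mul x y)

/-- `L(S)`, the set of all left multiplications `L_y : x ↦ S(y, x)`. -/
def leftSpreadSet (S : SemifieldOn F K) : Set (Module.End F K) :=
  {f | ∃ y : K, f = S.mul y}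

end SemifieldOn

/-! ### Spreads of `E = End_F(K)` -/

/-- The subspace `⟨B_D(L)⟩` of `V` spanned by those elements of `D` that contain a point of `L`
(that is, a nonzero vector of `L`). -/
def spanB {F V : Type*} [Field F] [AddCommGroup V] [Module F V] (D : Set (Submodule F V))
    (L : Set V) : Submodule F V :=
  sSup {X | X ∈ D ∧ ∃ f ∈ L, f ≠ 0 ∧ f ∈ X}

/-- The Desarguesian spread `D_r`: the spaces `{f α : α ∈ K}` for nonzero `f` in `End_F(K)`, where
`f α` is the map `x ↦ f (α x)`. -/
def Dr (F K : Type*) [Field F] [Field K] [Algebra F K] : Set (Submodule F (Module.End F K)) :=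
  {X : Submodule F (Module.End F K) | ∃ f : Module.End F K, f ≠ 0 ∧
    (X : Set (Module.End F K)) = {g | ∃ α : K, g = f ∘ₗ LinearMap.mulLeft F α}}

/-- The family `F_r` of maximal subspaces of the Segre variety (the rank one endomorphisms) that is
contained in `D_r`: for each one-dimensional `⟨c⟩`, the endomorphisms with image in `⟨c⟩`. -/
def Fr (F K : Type*) [Field F] [Field K] [Algebra F K] : Set (Submodule F (Module.End F K)) :=
  {X : Submodule F (Module.End F K) | ∃ c : K, c ≠ 0 ∧
    (X : Set (Module.End F K)) = {f | LinearMap.range f ≤ Submodule.span F {c}}}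

end BEL

end

noncomputable section

namespace BEL

/-! ### Spans of spread sets over a field acting on the domain -/

/-! All three quantities are controlled by one invariant. For an additive bijection θ from K to the
semifield R, `rightSpan θ` is the K-span of the maps a ↦ x * θ a, with K acting by precomposition
with multiplications. If r is its least K-dimension over all θ, then the BEL-rank is r and both
minima are n * r. Sizes are compared by cardinality, so that different base fields can be handled
together.

For the BEL-rank, a K-basis of the span factors the multiplication as x * θ a = H (a • G x), and the
image of G and the kernel of H form a configuration (`exists_factorization`,
`exists_BELConfiguration`). Conversely, a configuration yields such a θ
(`exists_bijection_of_spread`). The spread element coming from V(rn, k) is either S_∞, which gives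
the left multiplications directly, or a graph, which gives their inverses; in the latter case
`exists_left_mul_eq_of_inverse` shows that the inverses of left multiplications are again left
multiplications.

In E, a Desarguesian spread containing F_r comes from an action by precomposition
(`apply_eq_comp_of_stable`), so evaluation at 1 produces a θ. Conversely, conjugating either the
semifield or the spread by θ realizes the span of θ inside E.

The configuration has to be built over the centre Z, while the θ obtained from the geometry is only
additive. The gap is closed by `exists_linear_card_rightSpan_le`: θ splits into semilinear
components over Z, each becomes Z-linear after a twist by an automorphism of K, and a suitable
K-combination of the results is bijective with no larger span. -/

/-- The additive maps `K → V`, as a vector space over `K` by `(a • f) b = f (a b)`. -/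
def DomHom (K V : Type*) [Field K] [AddCommGroup V] : Type _ := K →+ V

namespace DomHom

variable {K V : Type*} [Field K] [AddCommGroup V]

instance : AddCommGroup (DomHom K V) := inferInstanceAs (AddCommGroup (K →+ V))

instance : FunLike (DomHom K V) K V := inferInstanceAs (FunLike (K →+ V) K V)

instance : AddMonoidHomClass (DomHom K V) K V :=
  inferInstanceAs (AddMonoidHomClass (K →+ V) K V)

instance [Finite K] [Finite V] : Finite (DomHom K V) := DFunLike.finite _

/-- An additive map, as an element of `DomHom K V`. -/
def of (f : K →+ V) : DomHom K V := f

@[simp] theorem of_apply (f : K →+ V) (a : K) : of f a = f a := rfl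

@[ext] theorem ext {f g : DomHom K V} (h : ∀ a, f a = g a) : f = g := DFunLike.ext _ _ h

@[simp] theorem add_apply (f g : DomHom K V) (a : K) : (f + g) a = f a + g a := rfl

@[simp] theorem zero_apply (a : K) : (0 : DomHom K V) a = 0 := rfl

theorem sum_apply {ι : Type*} (s : Finset ι) (f : ι → DomHom K V) (a : K) :
    (∑ i ∈ s, f i) a = ∑ i ∈ s, f i a :=
  AddMonoidHom.finsetSum_apply (N := V) (fun i => (f i : K →+ V)) s a

instance : Module K (DomHom K V) where
  smul a f := of ((f : K →+ V).comp (AddMonoidHom.mulLeft a))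
  one_smul f := ext fun b => congrArg f (one_mul b)
  mul_smul a b f := ext fun c => congrArg f (by
    change a * b * c = b * (a * c)
    ring)
  smul_zero a := rfl
  smul_add a f g := rfl
  add_smul a b f := ext fun c => by
    change f ((a + b) * c) = f (a * c) + f (b * c)
    rw [add_mul, map_add]
  zero_smul f := ext fun c => by
    change f (0 * c) = 0
    rw [zero_mul, map_zero]

@[simp] theorem smul_apply (a : K) (f : DomHom K V) (b : K) : (a • f) b = f (a * b) := rfl

end DomHom

section RightSpan

variable {K R : Type*} [Field K] [NonAssocRing R]

/-- The `K`-span of the maps `a ↦ x * θ a`, for `x` in `R`. -/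
def rightSpan (θ : K →+ R) : Submodule K (DomHom K R) :=
  Submodule.span K (Set.range fun x : R => DomHom.of ((AddMonoidHom.mulLeft x).comp θ))

theorem mulLeft_comp_mem_rightSpan (θ : K →+ R) (x : R) :
    DomHom.of ((AddMonoidHom.mulLeft x).comp θ) ∈ rightSpan θ :=
  Submodule.subset_span ⟨x, rfl⟩

theorem card_rightSpan [Finite K] [Finite R] (θ : K →+ R) :
    Nat.card (rightSpan θ) = Nat.card K ^ Module.finrank K (rightSpan θ) :=
  Module.natCard_eq_pow_finrank

/-- If all left multiplications have the form `θ b ↦ H (b • v)`, with `v` in a `K`-stable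
set `X`, then the span of the left multiplications is no larger than `X`. -/
theorem card_rightSpan_le {M : Type*} [AddCommGroup M] [Module K M] (X : Submodule K M) [Finite X]
    (θ : K →+ R) (H : M →+ R) (h : ∀ x : R, ∃ v ∈ X, ∀ b : K, x * θ b = H (b • v)) :
    Nat.card (rightSpan θ) ≤ Nat.card X := by
  -- This map is K-linear because K acts on `DomHom K R` by precomposition.
  let T : M →ₗ[K] DomHom K R :=
    { toFun := fun v => DomHom.of
        { toFun := fun b => H (b • v)
          map_zero' := by simp
          map_add' := fun a b => by rw [add_smul, map_add] }
      map_add' := fun v w => DomHom.ext fun b => by simp [smul_add]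
      map_smul' := fun a v => DomHom.ext fun b => by simp [smul_smul, mul_comm] }
  have hle : rightSpan θ ≤ X.map T := by
    refine Submodule.span_le.mpr ?_
    rintro _ ⟨x, rfl⟩
    obtain ⟨v, hv, hx⟩ := h x
    exact ⟨v, hv, DomHom.ext fun b => (hx b).symm⟩
  have : Finite (X.map T) := Set.Finite.image T (Set.toFinite (X : Set M))
  calc Nat.card (rightSpan θ) ≤ Nat.card (X.map T) := Nat.card_mono (Set.toFinite _) hle
    _ ≤ Nat.card X := by
      refine Nat.card_le_card_of_surjective (fun v : X => (⟨T v, v, v.2, rfl⟩ : X.map T)) ?_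
      rintro ⟨_, v, hv, rfl⟩
      exact ⟨⟨v, hv⟩, rfl⟩

end RightSpan

/-! ### Combinations of linear maps from a field -/

section Combination

variable {Z K V : Type*} [Field Z] [Field K] [Algebra Z K] [AddCommGroup V] [Module Z V]

theorem card_dual_eq [Finite V] [Finite Z] : Nat.card (Module.Dual Z V) = Nat.card V := by
  rw [Module.natCard_eq_pow_finrank (K := Z), Module.natCard_eq_pow_finrank (K := Z) (V := V),
    Subspace.dual_finrank_eq]

theorem card_ker_mul_card {A B : Type*} [AddCommGroup A] [AddCommGroup B] (f : A →+ B)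
    (hf : Function.Surjective f) : Nat.card f.ker * Nat.card B = Nat.card A := by
  rw [AddSubgroup.card_eq_card_quotient_mul_card_addSubgroup f.ker, mul_comm,
    Nat.card_congr (QuotientAddGroup.quotientKerEquivOfSurjective f hf).toEquiv]

/-- If no nonzero functional vanishes on all images of the maps `h i`, then some combination of the
maps `h i`, with coefficients in `K`, is bijective. -/
theorem exists_bijective_combination [Finite K] [Finite V] {ι : Type*} [Fintype ι]
    (hcard : Nat.card K = Nat.card V) (h : ι → K →ₗ[Z] V)
    (hh : ∀ l : Module.Dual Z V, (∀ i, l ∘ₗ h i = 0) → l = 0) :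
    ∃ c : ι → K, Function.Bijective (∑ i, h i ∘ₗ LinearMap.mulLeft Z (c i) : K →ₗ[Z] V) := by
  classical
  have : Finite Z := Finite.of_injective _ (algebraMap Z K).injective
  have : Finite (Module.Dual Z V) := Module.finite_of_finite Z
  have : Finite (Module.Dual Z K) := Module.finite_of_finite Z
  have := Fintype.ofFinite K
  have := Fintype.ofFinite (Module.Dual Z V)
  -- For fixed l this is additive in the coefficients; a coefficient vector is bad when some nonzero
  -- l sends it to 0.
  let T (l : Module.Dual Z V) : (ι → K) →+ Module.Dual Z K :=
    { toFun := fun c => l ∘ₗ ∑ i, h i ∘ₗ LinearMap.mulLeft Z (c i)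
      map_zero' := by ext; simp
      map_add' := fun c d => by ext; simp [add_mul, Finset.sum_add_distrib] }
  -- Varying one coefficient i with l ∘ h i nonzero already gives an injection of K into its dual,
  -- which has the same size.
  have hT (l) (hl : l ≠ 0) : Function.Surjective (T l) := by
    obtain ⟨i, hi⟩ : ∃ i, l ∘ₗ h i ≠ 0 := by
      by_contra! H
      exact hl (hh l H)
    have hinj : Function.Injective fun a : K => T l (Pi.single i a) := by
      have : Function.Injective ((T l).comp (AddMonoidHom.single (fun _ : ι => K) i)) := by
        rw [injective_iff_map_eq_zero]
        intro a ha
        by_contra ha0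
        refine hi (LinearMap.ext fun b => ?_)
        have hb := LinearMap.congr_fun ha (a⁻¹ * b)
        simp only [AddMonoidHom.coe_comp, Function.comp_apply, AddMonoidHom.single_apply,
          AddMonoidHom.coe_mk, ZeroHom.coe_mk, T, LinearMap.comp_apply, LinearMap.sum_apply,
          LinearMap.mulLeft_apply] at hb
        rw [Finset.sum_eq_single i (by intro j _ hj; simp [Pi.single_eq_of_ne hj]) (by simp),
          Pi.single_eq_same, mul_inv_cancel_left₀ ha0] at hb
        simpa using hb
      exact this
    have hbij := (Nat.bijective_iff_injective_and_card _).mpr ⟨hinj, card_dual_eq.symm⟩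
    exact fun f => ⟨_, (hbij.2 f).choose_spec⟩
  by_contra! H
  -- If every combination fails to be onto, each has its image in the kernel of some nonzero
  -- functional.
  have hcover : (Finset.univ : Finset (ι → K)) ⊆
      (Finset.univ.erase (0 : Module.Dual Z V)).biUnion
        fun l => Finset.univ.filter fun c => T l c = 0 := by
    intro c _
    have hns : ¬ Function.Surjective (∑ i, h i ∘ₗ LinearMap.mulLeft Z (c i) : K →ₗ[Z] V) :=
      fun hs => H c ((Nat.bijective_iff_surjective_and_card _).mpr ⟨hs, hcard⟩)
    have hr : LinearMap.range (∑ i, h i ∘ₗ LinearMap.mulLeft Z (c i)) < ⊤ :=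
      lt_top_iff_ne_top.mpr fun hr => hns (LinearMap.range_eq_top.mp hr)
    obtain ⟨l, hl, hl'⟩ := Submodule.exists_le_ker_of_lt_top _ hr
    simp only [Finset.mem_biUnion, Finset.mem_erase, Finset.mem_univ, and_true, Finset.mem_filter,
      true_and]
    exact ⟨l, hl, LinearMap.ext fun b => hl' ⟨b, rfl⟩⟩
  have hker (l) (hl : l ∈ Finset.univ.erase (0 : Module.Dual Z V)) :
      (Finset.univ.filter fun c => T l c = 0).card ≤ Nat.card (ι → K) / Nat.card K := by
    have h1 := card_ker_mul_card (T l) (hT l (Finset.ne_of_mem_erase hl))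
    rw [card_dual_eq] at h1
    rw [← h1, Nat.mul_div_cancel _ Nat.card_pos, Nat.card_eq_fintype_card,
      Fintype.card_subtype]
    simp only [AddMonoidHom.mem_ker]
    exact le_rfl
  -- There are only |K| - 1 nonzero functionals, and each accounts for a fraction 1/|K| of the
  -- coefficient vectors, so they cannot cover everything.
  have h1 := (Finset.card_le_card hcover).trans (Finset.card_biUnion_le_card_mul _ _ _ hker)
  rw [Finset.card_erase_of_mem (Finset.mem_univ _), Finset.card_univ, Finset.card_univ,
    ← Nat.card_eq_fintype_card, ← Nat.card_eq_fintype_card, card_dual_eq, ← hcard] at h1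
  have h2 := Nat.mul_div_le (Nat.card (ι → K)) (Nat.card K)
  have h3 : 0 < Nat.card (ι → K) / Nat.card K := by
    rcases Nat.eq_zero_or_pos (Nat.card (ι → K) / Nat.card K) with h0 | h0
    · rw [h0, mul_zero] at h1
      exact absurd h1 (not_le.mpr Nat.card_pos)
    · exact h0
  have h4 : 0 < Nat.card K := Nat.card_pos
  obtain ⟨m, hm⟩ := Nat.exists_eq_succ_of_ne_zero h4.ne'
  rw [hm] at h1 h2 h3
  simp only [Nat.succ_eq_add_one, Nat.add_sub_cancel] at h1 h2 h3
  nlinarith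

end Combination

/-! ### From maps over a subfield of the centre to maps over the centre -/

section Semilinear

variable {k Z K V : Type*} [Field k] [Field Z] [Field K] [Algebra k Z] [Algebra Z K]
  [AddCommGroup V] [Module Z V]

/-- Dedekind's independence of characters, tested against linear functionals. It makes sums of
semilinear maps with distinct automorphisms direct. -/
theorem eq_zero_of_sum_automorphism_smul_eq_zero (v : (Z ≃ₐ[k] Z) → V) [Fintype (Z ≃ₐ[k] Z)]
    (h : ∀ z : Z, ∑ τ, τ z • v τ = 0) : v = 0 := by
  funext σ
  refine (Module.forall_dual_apply_eq_zero_iff Z (v σ)).mp fun l => ?_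
  have hli : LinearIndependent Z fun τ : Z ≃ₐ[k] Z => ((τ : Z →* Z) : Z → Z) :=
    (linearIndependent_monoidHom Z Z).comp (fun τ : Z ≃ₐ[k] Z => (τ : Z →* Z)) fun τ₁ τ₂ h12 =>
      AlgEquiv.ext fun z => DFunLike.congr_fun h12 z
  refine Fintype.linearIndependent_iff.mp hli (fun τ => l (v τ)) ?_ σ
  funext z
  have := congrArg l (h z)
  simpa [Finset.sum_apply, mul_comm] using this

variable [Finite Z] [Algebra k K] [IsScalarTower k Z K] [Module k V] [IsScalarTower k Z V]
  {ι : Type*} [Fintype ι] [DecidableEq ι]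

theorem sum_trace_traceDual_smul (b : Module.Basis ι k Z) (z : Z) :
    ∑ j, Algebra.trace k Z (z * b.traceDual j) • b j = z := by
  have : Module.Finite k Z := Module.Finite.of_basis b
  conv_rhs => rw [← b.sum_repr z]
  refine Finset.sum_congr rfl fun j _ => ?_
  conv_rhs => rw [← Module.Basis.traceDual_traceDual (b := b)]
  rw [Module.Basis.traceDual_repr_apply, Algebra.traceForm_apply, b.traceDual_traceDual]

/-- The `τ`-semilinear component of a `k`-linear map `θ`. -/
def semiComponent (b : Module.Basis ι k Z) (τ : Z ≃ₐ[k] Z) (θ : K →ₗ[k] V) : K →+ V where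
  toFun a := ∑ j, τ (b.traceDual j) • θ (b j • a)
  map_zero' := by simp
  map_add' a a' := by simp [Finset.sum_add_distrib]

omit [IsScalarTower k Z K] [IsScalarTower k Z V] in
theorem semiComponent_apply (b : Module.Basis ι k Z) (τ : Z ≃ₐ[k] Z) (θ : K →ₗ[k] V) (a : K) :
    semiComponent b τ θ a = ∑ j, τ (b.traceDual j) • θ (b j • a) := rfl

/-- Expanding z * b j in the basis, and z times a dual vector in the dual basis, involves the same
trace coefficients, so z moves across the sum and emerges under τ. -/
theorem semiComponent_smul (b : Module.Basis ι k Z) (τ : Z ≃ₐ[k] Z) (θ : K →ₗ[k] V) (z : Z)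
    (a : K) : semiComponent b τ θ (z • a) = τ z • semiComponent b τ θ a := by
  have h1 (j : ι) : θ (b j • z • a) =
      ∑ i, Algebra.trace k Z (b j * z * b.traceDual i) • θ (b i • a) := by
    conv_lhs => rw [smul_smul, ← sum_trace_traceDual_smul b (b j * z), Finset.sum_smul, map_sum]
    exact Finset.sum_congr rfl fun i _ => by rw [smul_assoc, θ.map_smul]
  have h2 (i : ι) : ∑ j, Algebra.trace k Z (b j * z * b.traceDual i) • b.traceDual j =
      z * b.traceDual i := by
    conv_rhs => rw [← sum_trace_traceDual_smul b.traceDual (z * b.traceDual i)]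
    exact Finset.sum_congr rfl fun j _ => by
      rw [Module.Basis.traceDual_traceDual, mul_comm (z * _), mul_assoc]
  simp only [semiComponent_apply, h1, Finset.smul_sum]
  rw [Finset.sum_comm]
  refine Finset.sum_congr rfl fun i _ => ?_
  rw [smul_smul, ← map_mul, ← h2 i, map_sum, Finset.sum_smul]
  exact Finset.sum_congr rfl fun j _ => by
    rw [map_smul τ, smul_assoc, smul_comm]

/-- Summing over τ turns the dual basis elements into their traces, which are the coordinates of 1
in the basis. -/
theorem sum_semiComponent [Fintype (Z ≃ₐ[k] Z)] (b : Module.Basis ι k Z) (θ : K →ₗ[k] V) (a : K) :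
    ∑ τ : Z ≃ₐ[k] Z, semiComponent b τ θ a = θ a := by
  have : Module.Finite k Z := Module.Finite.of_basis b
  simp only [semiComponent_apply]
  rw [Finset.sum_comm]
  conv_rhs => rw [← one_smul Z a, ← sum_trace_traceDual_smul b 1, Finset.sum_smul, map_sum]
  refine Finset.sum_congr rfl fun j _ => ?_
  rw [← Finset.sum_smul, one_mul, smul_assoc, θ.map_smul, ← algebraMap_smul (R := k) Z,
    trace_eq_sum_automorphisms]
  congr 1
  exact Finset.sum_congr (Finset.ext fun _ => by simp) fun _ _ => rfl

end Semilinear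

/-! ### Replacing an additive bijection by one linear over the centre -/

section Descent

variable {k Z K R : Type*} [Field k] [Field Z] [Field K] [Finite K]
  [Algebra k Z] [Algebra Z K] [Algebra k K] [IsScalarTower k Z K]
  [NonAssocRing R] [Finite R] [Module Z R] [IsScalarTower Z R R] [SMulCommClass Z R R]

omit [Finite K] [Algebra k K] [IsScalarTower k Z K] [Finite R] [IsScalarTower Z R R] in
theorem semilinear_of_mem_rightSpan (τ : Z ≃ₐ[k] Z) (θ : K →+ R)
    (hθ : ∀ (z : Z) (a : K), θ (z • a) = τ z • θ a) {f : DomHom K R} (hf : f ∈ rightSpan θ)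
    (z : Z) (a : K) : f (z • a) = τ z • f a := by
  induction hf using Submodule.span_induction generalizing a with
  | mem f hf =>
    obtain ⟨x, rfl⟩ := hf
    simp [hθ, mul_smul_comm]
  | zero => simp
  | add f g _ _ hf hg => simp [hf, hg]
  | smul c f _ hf => simpa using hf (c * a)

variable [Module k R] [IsScalarTower k Z R]

-- The scalar τ(b*) can be absorbed into the left factor x, and b j acts on the argument as an
-- element of K, so each component's multiplications are K-combinations of those of θ.
omit [Finite K] [IsScalarTower k Z K] [Finite R] [IsScalarTower k Z R] in
theorem rightSpan_semiComponent_le {ι : Type*} [Fintype ι] [DecidableEq ι] [Finite Z]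
    (b : Module.Basis ι k Z) (τ : Z ≃ₐ[k] Z) (θ : K →ₗ[k] R) :
    rightSpan (semiComponent b τ θ) ≤ rightSpan θ.toAddMonoidHom := by
  refine Submodule.span_le.mpr ?_
  rintro _ ⟨x, rfl⟩
  have : DomHom.of ((AddMonoidHom.mulLeft x).comp (semiComponent b τ θ)) =
      ∑ j, algebraMap Z K (b j) • DomHom.of
        ((AddMonoidHom.mulLeft (τ (b.traceDual j) • x)).comp θ.toAddMonoidHom) := by
    ext a
    simp [DomHom.sum_apply, semiComponent_apply, Finset.mul_sum, mul_smul_comm, smul_mul_assoc,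
      Algebra.smul_def]
  beta_reduce
  rw [this]
  exact Submodule.sum_mem _ fun j _ => Submodule.smul_mem _ _ (mulLeft_comp_mem_rightSpan _ _)

/-- A bijection `K → R` that is linear over a subfield `k` of a field `Z` over which `R` is an
algebra can be replaced by one linear over `Z`, without enlarging the span of left
multiplications. -/
theorem exists_linear_card_rightSpan_le (θ : K →ₗ[k] R) (hθ : Function.Bijective θ) :
    ∃ θ' : K →ₗ[Z] R, Function.Bijective θ' ∧
      Nat.card (rightSpan θ'.toAddMonoidHom) ≤ Nat.card (rightSpan θ.toAddMonoidHom) := by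
  classical
  have : Finite Z := Finite.of_injective _ (algebraMap Z K).injective
  have : Finite k := Finite.of_injective _ (algebraMap k K).injective
  let b := Module.finBasis k Z
  have := Fintype.ofFinite (Z ≃ₐ[k] Z)
  let lift (τ : Z ≃ₐ[k] Z) : K ≃ₐ[k] K := τ.liftNormal K
  have hlift (τ : Z ≃ₐ[k] Z) (z : Z) : lift τ (algebraMap Z K z) = algebraMap Z K (τ z) :=
    τ.liftNormal_commutes K z
  have hlift' (τ : Z ≃ₐ[k] Z) (z : Z) :
      (lift τ).symm (algebraMap Z K (τ z)) = algebraMap Z K z := by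
    rw [← hlift, AlgEquiv.symm_apply_apply]
  -- Precomposing with the inverse of an extension of τ to K cancels the semilinearity.
  let h (τ : Z ≃ₐ[k] Z) : K →ₗ[Z] R :=
    { toFun := fun a => semiComponent b τ θ ((lift τ).symm a)
      map_add' := fun a a' => by simp
      map_smul' := fun z a => by
        obtain ⟨z, rfl⟩ := τ.surjective z
        rw [Algebra.smul_def, map_mul, hlift', ← Algebra.smul_def, semiComponent_smul,
          RingHom.id_apply] }
  -- A functional killing every component of θ kills θ, which is onto.
  have hsep (l : Module.Dual Z R) (hl : ∀ τ, l ∘ₗ h τ = 0) : l = 0 := by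
    refine LinearMap.ext fun v => ?_
    obtain ⟨a, rfl⟩ := hθ.2 v
    rw [← sum_semiComponent b θ a, map_sum]
    refine Finset.sum_eq_zero fun τ _ => ?_
    simpa [h] using LinearMap.congr_fun (hl τ) (lift τ a)
  obtain ⟨c, hc⟩ := exists_bijective_combination (Nat.card_congr (Equiv.ofBijective θ hθ)) h hsep
  refine ⟨_, hc, ?_⟩
  -- The product of the component spans serves as an intermediary: it embeds in the span of θ by
  -- untwisted sums, and it maps onto N below by twisted sums.
  let Φ : (∀ τ : Z ≃ₐ[k] Z, rightSpan (semiComponent b τ θ)) →+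
      DomHom K R :=
    { toFun := fun f => ∑ τ, (f τ : DomHom K R)
      map_zero' := by simp
      map_add' := fun f g => by simp [Finset.sum_add_distrib] }
  have hΦinj : Function.Injective Φ := by
    refine (injective_iff_map_eq_zero Φ).mpr fun f hf => ?_
    have h0 (a : K) : (fun τ => (f τ : DomHom K R) a) = 0 := by
      refine eq_zero_of_sum_automorphism_smul_eq_zero (k := k) (Z := Z) _ fun z => ?_
      have := DFunLike.congr_fun hf (z • a)
      simp only [Φ, AddMonoidHom.coe_mk, ZeroHom.coe_mk, DomHom.sum_apply, DomHom.zero_apply]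
        at this
      rw [← this]
      exact Finset.sum_congr rfl fun τ _ =>
        (semilinear_of_mem_rightSpan τ _ (semiComponent_smul b τ θ) (f τ).2 z a).symm
    exact funext fun τ => Subtype.ext (DomHom.ext fun a => congrFun (h0 a) τ)
  let twist (τ : Z ≃ₐ[k] Z) (f : DomHom K R) : DomHom K R :=
    DomHom.of ((f : K →+ R).comp (lift τ).symm.toRingEquiv.toRingHom.toAddMonoidHom)
  have twist_apply (τ f a) : twist τ f a = f ((lift τ).symm a) := rfl
  let N : Submodule K (DomHom K R) :=
    { carrier := Set.range fun f : ∀ τ : Z ≃ₐ[k] Z, rightSpan (semiComponent b τ θ) => ∑ τ, twist τ (f τ)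
      zero_mem' := ⟨0, DomHom.ext fun a => by simp [DomHom.sum_apply, twist_apply]⟩
      add_mem' := by
        rintro _ _ ⟨f, rfl⟩ ⟨g, rfl⟩
        exact ⟨f + g, DomHom.ext fun a => by
          simp [DomHom.sum_apply, twist_apply, Finset.sum_add_distrib]⟩
      smul_mem' := by
        rintro a _ ⟨f, rfl⟩
        exact ⟨fun τ => (lift τ).symm a • f τ, DomHom.ext fun a => by
          simp [DomHom.sum_apply, twist_apply]⟩ }
  have hle : rightSpan (∑ τ, h τ ∘ₗ LinearMap.mulLeft Z (c τ) : K →ₗ[Z] R).toAddMonoidHom ≤ N := by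
    refine Submodule.span_le.mpr ?_
    rintro _ ⟨x, rfl⟩
    -- Multiplication by c τ precedes the twist, so it passes through as its image under the inverse
    -- of the lift.
    refine ⟨fun τ => (lift τ).symm (c τ) • ⟨_, mulLeft_comp_mem_rightSpan _ x⟩,
      DomHom.ext fun a => ?_⟩
    simp [DomHom.sum_apply, twist_apply, h, Finset.mul_sum]
  calc _ ≤ Nat.card N := Nat.card_mono (Set.toFinite _) hle
    _ ≤ Nat.card (∀ τ : Z ≃ₐ[k] Z, rightSpan (semiComponent b τ θ)) :=
      Nat.card_le_card_of_surjective
        (fun f : ∀ τ : Z ≃ₐ[k] Z, rightSpan (semiComponent b τ θ) => (⟨_, f, rfl⟩ : N))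
        (by
          rintro ⟨_, f, rfl⟩
          exact ⟨f, rfl⟩)
    _ ≤ _ := Nat.card_le_card_of_injective
        (fun f : ∀ τ : Z ≃ₐ[k] Z, rightSpan (semiComponent b τ θ) => (⟨Φ f, Submodule.sum_mem _ fun τ _ =>
          rightSpan_semiComponent_le b τ θ (f τ).2⟩ : rightSpan θ.toAddMonoidHom))
        fun f g hfg => hΦinj (congrArg Subtype.val hfg)

end Descent

/-! ### Desarguesian spreads from actions of a field -/

section Lines

variable {k K V : Type*} [Field k] [Field K] [Algebra k K] [AddCommGroup V] [Module k V]

/-- The one-dimensional subspaces for an action of the field `K` on `V`. -/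
def lines (ρ : K →ₐ[k] Module.End k V) : Set (Submodule k V) :=
  {X | ∃ v : V, v ≠ 0 ∧ (X : Set V) = {w | ∃ a : K, ρ a v = w}}

theorem isDesarguesianSpread_lines [Nontrivial V] {n : ℕ} (hn : Module.finrank k K = n)
    (ρ : K →ₐ[k] Module.End k V) : IsDesarguesianSpread k V n (lines ρ) := by
  let e : K ≃ₐ[k] ρ.range := AlgEquiv.ofInjective ρ ρ.toRingHom.injective
  refine ⟨ρ.range, e.symm.toMulEquiv.isField (Field.toIsField K),
    e.symm.toLinearEquiv.finrank_eq.trans hn, ?_⟩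
  ext X
  simp only [lines, Set.mem_ofPred_eq, AlgHom.mem_range]
  refine exists_congr fun v => and_congr_right fun _ => ?_
  have : {w | ∃ a : K, ρ a v = w} = {w | ∃ a : Module.End k V, (∃ x, ρ x = a) ∧ a v = w} := by
    ext w
    simp
  rw [this]

/-- The line through `v` for an action of the field `K`. -/
def line (ρ : K →ₐ[k] Module.End k V) (v : V) : Submodule k V :=
  LinearMap.range ((LinearMap.applyₗ v).comp ρ.toLinearMap)

theorem coe_line (ρ : K →ₐ[k] Module.End k V) (v : V) :
    (line ρ v : Set V) = {w | ∃ a : K, ρ a v = w} := by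
  ext w
  simp [line]

theorem mem_line {ρ : K →ₐ[k] Module.End k V} {v w : V} :
    w ∈ line ρ v ↔ ∃ a : K, ρ a v = w := by
  simp [line]

theorem mem_lines {ρ : K →ₐ[k] Module.End k V} {X : Submodule k V} :
    X ∈ lines ρ ↔ ∃ v, v ≠ 0 ∧ X = line ρ v := by
  simp only [lines, Set.mem_ofPred_eq, ← coe_line, SetLike.coe_set_eq]

theorem line_eq_of_mem {ρ : K →ₐ[k] Module.End k V} {v w : V} (hw : w ≠ 0) (h : w ∈ line ρ v) :
    line ρ v = line ρ w := by
  obtain ⟨a, rfl⟩ := mem_line.mp h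
  have ha : a ≠ 0 := by
    rintro rfl
    simp at hw
  ext x
  simp only [mem_line]
  constructor
  · rintro ⟨b, rfl⟩
    exact ⟨b * a⁻¹, by rw [← Module.End.mul_apply, ← map_mul, inv_mul_cancel_right₀ ha]⟩
  · rintro ⟨b, rfl⟩
    exact ⟨b * a, by rw [map_mul, Module.End.mul_apply]⟩

theorem self_mem_line (ρ : K →ₐ[k] Module.End k V) (v : V) : v ∈ line ρ v :=
  mem_line.mpr ⟨1, by simp⟩

theorem finrank_submodule_prod {V' : Type*} [AddCommGroup V'] [Module k V'] [Module.Finite k V]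
    [Module.Finite k V'] (p : Submodule k V) (q : Submodule k V') :
    Module.finrank k (p.prod q) = Module.finrank k p + Module.finrank k q := by
  let e : p.prod q ≃ₗ[k] p × q :=
    { toFun := fun x => (⟨x.1.1, x.2.1⟩, ⟨x.1.2, x.2.2⟩)
      map_add' := fun _ _ => rfl
      map_smul' := fun _ _ => rfl
      invFun := fun x => ⟨(x.1, x.2), x.1.2, x.2.2⟩
      left_inv := fun _ => rfl
      right_inv := fun _ => rfl }
  rw [e.finrank_eq, Module.finrank_prod]

/-- Transport of an action of `K` by a linear equivalence. -/
def conjAction {M : Type*} [AddCommGroup M] [Module k M] [Module K M] [IsScalarTower k K M]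
    (e : M ≃ₗ[k] V) : K →ₐ[k] Module.End k V :=
  (e.conjAlgEquiv k).toAlgHom.comp (Algebra.lsmul k k M)

theorem conjAction_apply {M : Type*} [AddCommGroup M] [Module k M] [Module K M]
    [IsScalarTower k K M] (e : M ≃ₗ[k] V) (a : K) (v : V) :
    conjAction e a v = e (a • e.symm v) := rfl

end Lines

/-! ### A configuration from a linear bijection -/

section Upper

variable {k K R : Type*} [Field k] [Field K] [Algebra k K] [Finite K] [NonAssocRing R] [Finite R]
  [Module k R] [IsScalarTower k R R] [SMulCommClass k R R]

/-- G records the coordinates of the left multiplication by x in a K-basis of the span, and H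
evaluates the basis maps at the entries of a vector and adds. The product a • G x appears because
scalars act on the argument. -/
theorem exists_factorization (θ : K →ₗ[k] R) :
    ∃ (G : R →ₗ[k] Fin (Module.finrank K (rightSpan θ.toAddMonoidHom)) → K)
      (H : (Fin (Module.finrank K (rightSpan θ.toAddMonoidHom)) → K) →ₗ[k] R),
      ∀ x a, x * θ a = H (a • G x) := by
  let b := Module.finBasis K (rightSpan θ.toAddMonoidHom)
  let ℓ (x : R) : rightSpan θ.toAddMonoidHom := ⟨_, mulLeft_comp_mem_rightSpan _ x⟩
  have hlin (f : rightSpan θ.toAddMonoidHom) (c : k) (a : K) :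
      (f : DomHom K R) (c • a) = c • (f : DomHom K R) a :=
    semilinear_of_mem_rightSpan (AlgEquiv.refl : k ≃ₐ[k] k) _ (fun c a => θ.map_smul c a) f.2 c a
  refine ⟨{ toFun := fun x => b.equivFun (ℓ x), map_add' := fun x y => ?_, map_smul' := ?_ },
    { toFun := fun v => ∑ i, (b i : DomHom K R) (v i), map_add' := ?_, map_smul' := ?_ }, ?_⟩
  · rw [← map_add]
    exact congrArg _ (Subtype.ext (DomHom.ext fun a => by simp [ℓ, add_mul]))
  · intro c x
    have : ℓ (c • x) = algebraMap k K c • ℓ x :=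
      Subtype.ext (DomHom.ext fun a => by
        simp [ℓ, ← Algebra.smul_def, smul_mul_assoc, mul_smul_comm])
    rw [this, map_smul, algebraMap_smul, RingHom.id_apply]
  · intro v w
    simp [Finset.sum_add_distrib]
  · intro c v
    simp [hlin, Finset.smul_sum]
  · intro x a
    have h : (∑ i, b.equivFun (ℓ x) i • b i : rightSpan θ.toAddMonoidHom) = ℓ x :=
      b.sum_equivFun (ℓ x)
    have h' := DFunLike.congr_fun (congrArg Subtype.val h) a
    simp only [AddSubmonoidClass.coe_finsetSum, Submodule.coe_smul, DomHom.sum_apply,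
      DomHom.smul_apply] at h'
    simp only [LinearMap.coe_mk, AddHom.coe_mk, Pi.smul_apply, smul_eq_mul]
    simp only [mul_comm a]
    exact h'.symm

/-- The graph of a left multiplication. -/
def graphSubmodule (k : Type*) {R : Type*} [Field k] [NonAssocRing R] [Module k R]
    [SMulCommClass k R R] (x : R) : Submodule k (R × R) where
  carrier := {p | p.2 = x * p.1}
  zero_mem' := (mul_zero x).symm
  add_mem' {p q} hp hq := by
    change p.2 + q.2 = x * (p.1 + q.1)
    rw [hp, hq, mul_add]
  smul_mem' c p hp := by
    change c • p.2 = x * (c • p.1)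
    rw [hp, mul_smul_comm]

variable [Nontrivial R] [NoZeroDivisors R]

/-- In coordinates, U is the image of G and W is the kernel of H. A spread element meeting both
would give x * θ a = 0 with x and a nonzero, so the absence of zero divisors is exactly the
configuration condition. -/
theorem exists_BELConfiguration {r : ℕ} (θ : K →ₗ[k] R) (hθ : Function.Bijective θ)
    (G : R →ₗ[k] Fin r → K) (H : (Fin r → K) →ₗ[k] R) (hGH : ∀ x a, x * θ a = H (a • G x)) :
    ∃ (D : Set (Submodule k (Fin (r * Module.finrank k R) → k)))
      (U W : Submodule k (Fin (r * Module.finrank k R) → k)),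
      IsBELConfiguration k (Module.finrank k R) r D U W ∧
      ∃ 𝒯, IsBELSpread k (Module.finrank k R) r D U W 𝒯 ∧ SpreadEquiv 𝒯 (semifieldSpread k R) := by
  have hfin : Module.Finite k R := Module.Finite.of_finite
  let eθ : K ≃ₗ[k] R := LinearEquiv.ofBijective θ hθ
  have hfinK : Module.Finite k K := Module.Finite.of_finite
  set n := Module.finrank k R with hn
  have hKn : Module.finrank k K = n := eθ.finrank_eq
  let e : (Fin r → K) ≃ₗ[k] (Fin (r * n) → k) := LinearEquiv.ofFinrankEq _ _ (by
    rw [Module.finrank_pi_fintype]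
    simp [hKn])
  let e₂ : K ≃ₗ[k] (Fin n → k) := LinearEquiv.ofFinrankEq _ _ (by simp [hKn])
  have hGinj : Function.Injective G := by
    refine (injective_iff_map_eq_zero G).mpr fun x hx => ?_
    obtain ⟨a, ha⟩ := hθ.2 1
    have := hGH x a
    rwa [hx, ha, mul_one, smul_zero, map_zero] at this
  have hHsurj : Function.Surjective H := fun y => by
    obtain ⟨a, ha⟩ := hθ.2 y
    exact ⟨a • G 1, by rw [← hGH, one_mul, ha]⟩
  have hG1 : G 1 ≠ 0 := fun h => one_ne_zero (hGinj (h.trans (map_zero G).symm))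
  have hntr : Nontrivial (Fin (r * n) → k) := e.symm.toEquiv.nontrivial_congr.mpr ⟨_, _, hG1⟩
  let ρ : K →ₐ[k] Module.End k (Fin (r * n) → k) := conjAction e
  let ρ' : K →ₐ[k] Module.End k (Ambient k n r) := conjAction (e.prodCongr e₂)
  let U : Submodule k (Fin (r * n) → k) := LinearMap.range (e.toLinearMap ∘ₗ G)
  let W : Submodule k (Fin (r * n) → k) := LinearMap.ker (H ∘ₗ e.symm.toLinearMap)
  have hU : Module.finrank k U = n :=
    LinearMap.finrank_range_of_inj (e.injective.comp hGinj)
  have hW : Module.finrank k W + n = r * n := by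
    have h1 := LinearMap.finrank_range_add_finrank_ker (H ∘ₗ e.symm.toLinearMap)
    rw [LinearMap.range_eq_top.mpr (by simpa using hHsurj), finrank_top,
      Module.finrank_fin_fun, add_comm] at h1
    exact h1
  have hρ'inl (a : K) (v) : ρ' a (v, 0) = (ρ a v, 0) := by
    simp [ρ', ρ, conjAction_apply]
  -- Through Φ, the K-line of the point (G x, c) of A becomes the set of pairs (c • θ a, x * θ a):
  -- the graph of left multiplication by c⁻¹ • x if c ≠ 0, and S_∞ if c = 0 and x ≠ 0.
  let A : Submodule k (Ambient k n r) := U.prod (k ∙ e₂ 1)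
  let Φ : Ambient k n r →ₗ[k] R × R :=
    ((θ ∘ₗ e₂.symm.toLinearMap) ∘ₗ LinearMap.snd k _ _).prod
      ((H ∘ₗ e.symm.toLinearMap) ∘ₗ LinearMap.fst k _ _)
  have hΦ (v w) : Φ (v, w) = (θ (e₂.symm w), H (e.symm v)) := rfl
  have hΦsurj : Function.Surjective Φ := by
    rintro ⟨y, z⟩
    obtain ⟨a, rfl⟩ := hθ.2 y
    obtain ⟨v, rfl⟩ := hHsurj z
    exact ⟨(e v, e₂ a), by simp [hΦ]⟩
  have hker : (embed W : Submodule k (Ambient k n r)) = LinearMap.ker Φ := by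
    ext ⟨v, w⟩
    simp only [Submodule.mem_map, LinearMap.inl_apply, Prod.mk.injEq, LinearMap.mem_ker, hΦ,
      Prod.mk_eq_zero]
    constructor
    · rintro ⟨v, hv, rfl, rfl⟩
      exact ⟨by simp, hv⟩
    · rintro ⟨hw, hv⟩
      exact ⟨v, hv, rfl, 
        (e₂.symm.map_eq_zero_iff.mp ((map_eq_zero_iff θ hθ.1).mp hw)).symm⟩
  let φ : (Ambient k n r ⧸ (embed W : Submodule k (Ambient k n r))) ≃ₗ[k] R × R :=
    (Submodule.quotEquivOfEq _ _ hker).trans (Φ.quotKerEquivOfSurjective hΦsurj)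
  have himage (X : Submodule k (Ambient k n r)) :
      φ '' (X.map (embed W : Submodule k (Ambient k n r)).mkQ : Submodule k _) = Φ '' X := by
    rw [Submodule.map_coe, Set.image_image]
    rfl
  have hΦline (x : R) (c : k) (a : K) :
      Φ (ρ' a (e (G x), c • e₂ 1)) = (c • θ a, x * θ a) := by
    simp [hΦ, ρ', conjAction_apply, hGH]
  have hvertical (x : R) (hx : x ≠ 0) :
      Φ '' (line ρ' (e (G x), (0 : k) • e₂ 1)) = {p : R × R | p.1 = 0} := by
    ext ⟨y, z⟩
    simp only [Set.mem_image, SetLike.mem_coe, mem_line, Set.mem_ofPred_eq]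
    constructor
    · rintro ⟨_, ⟨a, rfl⟩, h⟩
      rw [hΦline, zero_smul] at h
      exact (congrArg Prod.fst h).symm
    · rintro rfl
      have hinj : Function.Injective (AddMonoidHom.mulLeft x) :=
        (injective_iff_map_eq_zero _).mpr fun y hy => (mul_eq_zero.mp hy).resolve_left hx
      obtain ⟨y, hy⟩ := Finite.surjective_of_injective hinj z
      obtain ⟨a, rfl⟩ := hθ.2 y
      exact ⟨_, ⟨a, rfl⟩, (hΦline x 0 a).trans (Prod.ext (zero_smul _ _) hy)⟩
  have hgraph (x : R) (c : k) (hc : c ≠ 0) :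
      Φ '' (line ρ' (e (G x), c • e₂ 1)) = {p : R × R | p.2 = (c⁻¹ • x) * p.1} := by
    ext ⟨y, z⟩
    simp only [Set.mem_image, SetLike.mem_coe, mem_line, Set.mem_ofPred_eq]
    constructor
    · rintro ⟨_, ⟨a, rfl⟩, h⟩
      rw [hΦline] at h
      obtain ⟨rfl, rfl⟩ := Prod.mk.inj h
      rw [smul_mul_smul_comm, inv_mul_cancel₀ hc, one_smul]
    · rintro rfl
      obtain ⟨a, ha⟩ := hθ.2 (c⁻¹ • y)
      refine ⟨_, ⟨a, rfl⟩, (hΦline x c a).trans (Prod.ext ?_ ?_)⟩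
      · rw [ha, smul_inv_smul₀ hc]
      · rw [ha, mul_smul_comm, smul_mul_assoc]
  refine ⟨lines ρ, U, W, ⟨isDesarguesianSpread_lines hKn ρ, hU, hW, ?_⟩, _,
    ⟨lines ρ', A, isDesarguesianSpread_lines hKn ρ', ?_, ?_, ?_, rfl⟩, RingEquiv.refl k,
    φ.toAddEquiv, fun c v => φ.map_smul c v, ?_⟩
  · rintro _ hX ⟨hXU, hXW⟩
    obtain ⟨v, -, rfl⟩ := mem_lines.mp hX
    obtain ⟨u, ⟨hu, x, rfl⟩, hu0⟩ := Submodule.exists_mem_ne_zero_of_ne_bot hXU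
    obtain ⟨w, ⟨hw, hwW⟩, hw0⟩ := Submodule.exists_mem_ne_zero_of_ne_bot hXW
    rw [SetLike.mem_coe, line_eq_of_mem hu0 hu, mem_line] at hw
    obtain ⟨a, rfl⟩ := hw
    have h0 : x * θ a = 0 := by
      simpa [W, ρ, conjAction_apply, hGH] using hwW
    rcases mul_eq_zero.mp h0 with rfl | h0
    · exact hu0 (by simp)
    · rw [(map_eq_zero_iff θ hθ.1).mp h0, map_zero] at hw0
      exact hw0 rfl
  · intro X hX
    obtain ⟨v, hv, rfl⟩ := mem_lines.mp hX
    refine mem_lines.mpr ⟨(v, 0), fun h => hv (congrArg Prod.fst h), ?_⟩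
    ext x
    simp only [Submodule.mem_map, mem_line, hρ'inl, LinearMap.inl_apply]
    constructor
    · rintro ⟨_, ⟨a, rfl⟩, rfl⟩
      exact ⟨a, rfl⟩
    · rintro ⟨a, rfl⟩
      exact ⟨_, ⟨a, rfl⟩, rfl⟩
  · have h2 : e₂ 1 ≠ 0 := by simp
    rw [finrank_submodule_prod, hU,
      finrank_span_singleton h2]
  · ext ⟨v, w⟩
    simp only [A, Submodule.mem_inf, Submodule.mem_prod, Submodule.mem_map, LinearMap.inl_apply,
      Prod.mk.injEq, Submodule.mem_top, true_and]
    constructor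
    · rintro ⟨⟨hv, -⟩, _, rfl, rfl⟩
      exact ⟨_, hv, rfl, rfl⟩
    · rintro ⟨_, hv, rfl, rfl⟩
      exact ⟨⟨hv, Submodule.zero_mem _⟩, _, rfl, rfl⟩
  · ext s
    constructor
    · rintro ⟨_, ⟨X, hX, hXA, rfl⟩, rfl⟩
      obtain ⟨v, -, rfl⟩ := mem_lines.mp hX
      obtain ⟨⟨u, w⟩, ⟨hu, ⟨x, rfl⟩, hw⟩, hu0⟩ := Submodule.exists_mem_ne_zero_of_ne_bot hXA
      obtain ⟨c, rfl⟩ := Submodule.mem_span_singleton.mp hw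
      change φ '' _ ∈ _
      rw [line_eq_of_mem hu0 hu, himage]
      change Φ '' (line ρ' (e (G x), c • e₂ 1)) ∈ _
      rcases eq_or_ne c 0 with rfl | hc
      · have hx : x ≠ 0 := by
          rintro rfl
          exact hu0 (by simp)
        rw [hvertical x hx]
        exact ⟨LinearMap.ker (LinearMap.fst k R R), Or.inr rfl, rfl⟩
      · rw [hgraph x c hc]
        exact ⟨graphSubmodule k (c⁻¹ • x), Or.inl ⟨_, rfl⟩, rfl⟩
    · have hmem (x : R) (c : k) (hxc : x ≠ 0 ∨ c ≠ 0) (h : Φ '' (line ρ' (e (G x), c • e₂ 1)) = s) :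
          s ∈ (fun X : Submodule k _ => φ.toAddEquiv '' (X : Set _)) ''
            {Y | ∃ X ∈ lines ρ', X ⊓ A ≠ ⊥ ∧
              Y = X.map (embed W : Submodule k (Ambient k n r)).mkQ} := by
        have hne : ((e (G x), c • e₂ 1) : Ambient k n r) ≠ 0 := by
          simpa [Prod.ext_iff, map_eq_zero_iff G hGinj, or_iff_not_imp_left] using hxc
        refine ⟨_, ⟨_, mem_lines.mpr ⟨_, hne, rfl⟩, ?_, rfl⟩, (himage _).trans h⟩
        exact Submodule.ne_bot_iff _ |>.mpr ⟨_, ⟨self_mem_line _ _, ⟨x, rfl⟩,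
          Submodule.smul_mem _ _ (Submodule.mem_span_singleton_self _)⟩, hne⟩
      rintro ⟨Y, ⟨x, hY⟩ | hY, rfl⟩
      · exact hmem x 1 (Or.inr one_ne_zero) (by
          rw [hgraph x 1 one_ne_zero, inv_one, one_smul]
          exact hY.symm)
      · exact hmem 1 0 (Or.inl one_ne_zero) ((hvertical 1 one_ne_zero).trans hY.symm)

end Upper

/-! ### Recovering the multiplication from the spread -/

section Recover

variable {R K T : Type*} [NonAssocRing R] [Finite R] [Nontrivial R] [NoZeroDivisors R]
  [Field K] [AddCommGroup T] [Module K T]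

omit [Finite R] [Nontrivial R] in
theorem mul_left_cancel_of_ne_zero {x y z : R} (hx : x ≠ 0) (h : x * y = x * z) : y = z :=
  sub_eq_zero.mp ((mul_eq_zero.mp (by rw [mul_sub, h, sub_self])).resolve_left hx)

omit [Finite R] [Nontrivial R] in
theorem mul_right_cancel_of_ne_zero {x y z : R} (hx : x ≠ 0) (h : y * x = z * x) : y = z :=
  sub_eq_zero.mp ((mul_eq_zero.mp (by rw [sub_mul, h, sub_self])).resolve_right hx)

omit [Finite R] in
/-- If the inverses of the left multiplications form an additive group, this group consists of the
left multiplications themselves. -/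
theorem exists_left_mul_eq_of_inverse (U : AddSubgroup T) [Finite U]
    (hU : Nat.card U ≤ Nat.card R) (Q : K →+ R) (hQ : Function.Surjective Q) (H : T →+ R)
    (h : ∀ x : R, x ≠ 0 → ∃ u ∈ U, ∀ b : K, x * H (b • u) = Q b) (x : R) :
    ∃ u ∈ U, ∀ b : K, x * Q b = H (b • u) := by
  classical
  choose! u hu hxu using h
  have hu0 (x : R) (hx : x ≠ 0) : u x ≠ 0 := by
    intro h0
    obtain ⟨b, hb⟩ := hQ 1
    have := hxu x hx b
    rw [h0, smul_zero, map_zero, mul_zero, hb] at this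
    exact zero_ne_one this
  have hinj (x y : R) (hx : x ≠ 0) (hy : y ≠ 0) (hxy : u x = u y) : x = y := by
    obtain ⟨b, hb⟩ := hQ 1
    have h1 := hxu x hx b
    have h2 := hxu y hy b
    rw [← hxy, ← h1] at h2
    refine (mul_right_cancel_of_ne_zero (fun h0 => ?_) h2).symm
    rw [h0, mul_zero, hb] at h1
    exact zero_ne_one h1
  -- Counting shows that the vectors u x, together with 0, exhaust U; hence the inverses of left
  -- multiplications, with 0, are closed under subtraction.
  let f : R → U := fun x => if hx : x = 0 then 0 else ⟨u x, hu x hx⟩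
  have hf : Function.Injective f := by
    intro x y hxy
    by_cases hx : x = 0 <;> by_cases hy : y = 0 <;> simp only [f, hx, hy, dif_pos, dif_neg,
      not_false_eq_true, Subtype.ext_iff] at hxy ⊢
    · exact absurd hxy.symm (hu0 y hy)
    · exact absurd hxy (hu0 x hx)
    · exact hinj x y hx hy hxy
  have hfs : Function.Surjective f := ((Nat.bijective_iff_injective_and_card f).mpr
    ⟨hf, le_antisymm (Nat.card_le_card_of_injective f hf) hU⟩).2
  have hsurj (v : T) (hv : v ∈ U) (hv0 : v ≠ 0) : ∃ x, x ≠ 0 ∧ u x = v := by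
    obtain ⟨x, hx⟩ := hfs ⟨v, hv⟩
    by_cases hx0 : x = 0
    · simp only [f, hx0, dif_pos] at hx
      exact absurd (congrArg Subtype.val hx).symm hv0
    · simp only [f, hx0, dif_neg, not_false_eq_true] at hx
      exact ⟨x, hx0, congrArg Subtype.val hx⟩
  -- With L the left multiplication by x, the difference 1 - (1 + L)⁻¹ equals L (1 + L)⁻¹ and is the
  -- inverse of left multiplication by some z. Hence z acts as 1 + L⁻¹, and z - 1 acts as L⁻¹.
  have key (x : R) (hx : x ≠ 0) : ∃ w : R, ∀ v, w * (x * v) = v := by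
    by_cases hx1 : 1 + x = 0
    · exact ⟨-1, fun v => by rw [← neg_eq_of_add_eq_zero_right hx1]; simp⟩
    have hne : u 1 - u (1 + x) ≠ 0 := fun h0 => hx (by
      simpa using hinj 1 (1 + x) one_ne_zero hx1 (sub_eq_zero.mp h0))
    obtain ⟨z, hz, huz⟩ := hsurj _ (U.sub_mem (hu 1 one_ne_zero) (hu _ hx1)) hne
    refine ⟨z - 1, fun v => ?_⟩
    obtain ⟨b, hb⟩ := hQ ((1 + x) * v)
    have h1 := hxu _ hx1 b
    rw [hb] at h1
    have h2 := mul_left_cancel_of_ne_zero hx1 h1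
    have h3 := hxu 1 one_ne_zero b
    have h4 := hxu z hz b
    rw [one_mul] at h3
    rw [huz, smul_sub, map_sub, h3, h2, hb, add_mul, one_mul, add_sub_cancel_left] at h4
    rw [sub_mul, one_mul, h4, add_sub_cancel_right]
  rcases eq_or_ne x 0 with rfl | hx
  · exact ⟨0, U.zero_mem, fun b => by simp⟩
  obtain ⟨w, hw⟩ := key x hx
  have hw0 : w ≠ 0 := by
    rintro rfl
    exact zero_ne_one ((zero_mul _).symm.trans (hw 1))
  exact ⟨u w, hu w hw0, fun b => mul_left_cancel_of_ne_zero hw0 ((hw _).trans (hxu w hw0 b).symm)⟩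

/-- The two generators of the ambient space are a point m₀ of A off E₀, whose K-line parametrizes
one spread element by θ, and U, which measures the deviation of the other points of A from m₀. The
coordinates of R × R are chosen so that m₀ contributes only to θ and, up to a correction along E₀, U
only to H. -/
theorem exists_bijection_of_spread [Finite K] (hcard : Nat.card K = Nat.card R)
    (E₀ : Submodule K T) (Φ : T →+ R × R) (hker : ∀ v, Φ v = 0 → v ∈ E₀)
    (U : AddSubgroup T) [Finite U] (hU : Nat.card U ≤ Nat.card R) (hUE : ∀ u ∈ U, u ∈ E₀)
    (A : Set T)
    (hA : ∀ m₀ ∈ A, m₀ ∉ E₀ → ∀ m ∈ A, m ∉ E₀ → ∃ a : K, a • m - m₀ ∈ U)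
    (hE₀ : (∃ x : R, ∀ v ∈ E₀, (Φ v).2 = x * (Φ v).1) ∨ ∀ v ∈ E₀, (Φ v).1 = 0)
    (hgraph : ∀ x : R, ∃ m ∈ A, ∀ p : R × R, (∃ a : K, Φ (a • m) = p) ↔ p.2 = x * p.1)
    (hvert : ∃ m ∈ A, ∀ p : R × R, (∃ a : K, Φ (a • m) = p) ↔ p.1 = 0) :
    ∃ (θ : K →+ R) (H : T →+ R), Function.Bijective θ ∧
      ∀ x : R, ∃ u ∈ U, ∀ b : K, x * θ b = H (b • u) := by
  have hinj (m : T) (hm : m ∉ E₀) (a : K) (ha : Φ (a • m) = 0) : a = 0 := by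
    by_contra ha0
    exact hm ((E₀.smul_mem_iff ha0).mp (hker _ ha))
  have hbij (θ : K →+ R) (h : ∀ a, θ a = 0 → a = 0) : Function.Bijective θ :=
    (Nat.bijective_iff_injective_and_card θ).mpr ⟨(injective_iff_map_eq_zero θ).mpr h, hcard⟩
  let orb (m : T) : K →+ T := (smulAddHom K T).flip m
  rcases hE₀ with ⟨x₁, hx₁⟩ | hE₀
  · obtain ⟨m₀, hm₀, h₀⟩ := hvert
    have hm₀E : m₀ ∉ E₀ := fun hm => by
      obtain ⟨a, ha⟩ := (h₀ (0, 1)).mpr rfl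
      have := hx₁ _ (E₀.smul_mem a hm)
      rw [ha, mul_zero] at this
      exact one_ne_zero this
    have h₀1 (a : K) : (Φ (a • m₀)).1 = 0 := (h₀ _).mp ⟨a, rfl⟩
    let θ : K →+ R := ((AddMonoidHom.snd R R).comp Φ).comp (orb m₀)
    let H : T →+ R := (AddMonoidHom.fst R R).comp Φ
    have hθ : Function.Bijective θ := hbij θ fun a ha => hinj m₀ hm₀E a (Prod.ext (h₀1 a) ha)
    -- Here E₀ lies over the graph of x₁. Comparing it with the graph of x₁ + x gives x * H (b • u)
    -- = θ b, so H yields the inverse of left multiplication by x.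
    refine ⟨θ, H, hθ, exists_left_mul_eq_of_inverse U hU θ hθ.2 H fun x hx => ?_⟩
    obtain ⟨m, hm, hmx⟩ := hgraph (x₁ + x)
    have hmE : m ∉ E₀ := fun hmE => by
      obtain ⟨a, ha⟩ := (hmx (1, x₁ + x)).mpr (by simp)
      have := hx₁ _ (E₀.smul_mem a hmE)
      rw [ha] at this
      exact hx (by simpa using this)
    obtain ⟨a, hau⟩ := hA m₀ hm₀ hm₀E m hm hmE
    refine ⟨_, hau, fun b => ?_⟩
    have h1 := (hmx _).mp ⟨b * a, rfl⟩
    have h2 : (b * a) • m = b • m₀ + b • (a • m - m₀) := by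
      rw [smul_sub, smul_smul, add_sub_cancel]
    have h3 := hx₁ _ (E₀.smul_mem b (hUE _ hau))
    rw [h2, map_add, Prod.snd_add, Prod.fst_add, h₀1, zero_add, h3, add_mul, add_comm] at h1
    exact (add_left_cancel h1).symm
  · obtain ⟨m₀, hm₀, h₀⟩ := hgraph 0
    have hnot (x : R) (m : T) (hm : ∀ p : R × R, (∃ a : K, Φ (a • m) = p) ↔ p.2 = x * p.1) :
        m ∉ E₀ := fun hmE => by
      obtain ⟨a, ha⟩ := (hm (1, x)).mpr (by simp)
      have := hE₀ _ (E₀.smul_mem a hmE)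
      rw [ha] at this
      exact one_ne_zero this
    have hm₀E := hnot 0 m₀ h₀
    have h₀2 (a : K) : (Φ (a • m₀)).2 = 0 := ((h₀ _).mp ⟨a, rfl⟩).trans (zero_mul _)
    let θ : K →+ R := ((AddMonoidHom.fst R R).comp Φ).comp (orb m₀)
    let H : T →+ R := (AddMonoidHom.snd R R).comp Φ
    refine ⟨θ, H, hbij θ fun a ha => hinj m₀ hm₀E a (Prod.ext ha (h₀2 a)), fun x => ?_⟩
    obtain ⟨m, hm, hmx⟩ := hgraph x
    obtain ⟨a, hau⟩ := hA m₀ hm₀ hm₀E m hm (hnot x m hmx)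
    refine ⟨_, hau, fun b => ?_⟩
    have h1 := (hmx _).mp ⟨b * a, rfl⟩
    have h2 : (b * a) • m = b • m₀ + b • (a • m - m₀) := by
      rw [smul_sub, smul_smul, add_sub_cancel]
    have h3 := hE₀ _ (E₀.smul_mem b (hUE _ hau))
    rw [h2, map_add, Prod.snd_add, Prod.fst_add, h₀2, zero_add, h3, add_zero] at h1
    exact h1.symm

end Recover

/-! ### Lower bound for the rank of a configuration -/

section Lower

variable {k R K : Type*} [Field k] [NonAssocRing R] [Finite R] [Nontrivial R] [NoZeroDivisors R]
  [Module k R] [SMulCommClass k R R] [Field K] [Finite K]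

theorem mem_of_mem_desarguesianSpread {V : Type*} [AddCommGroup V] [Module k V] {n : ℕ}
    {D : Set (Submodule k V)} (hD : IsDesarguesianSpread k V n D) {v : V} (hv : v ≠ 0) :
    ∃ X ∈ D, v ∈ X := by
  obtain ⟨B, -, -, rfl⟩ := hD
  refine ⟨B.toSubmodule.map (LinearMap.applyₗ v), ⟨v, hv, ?_⟩, 1, B.one_mem, rfl⟩
  ext w
  simp

/-- The field that acts on a Desarguesian spread can be identified with any field of the same
order. -/
theorem exists_ringHom_of_isDesarguesianSpread [Finite k] {V : Type*} [AddCommGroup V]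
    [Module k V] {n : ℕ} (hn : n ≠ 0) (hcard : Nat.card K = Nat.card k ^ n)
    {D : Set (Submodule k V)} (hD : IsDesarguesianSpread k V n D) :
    ∃ ρ : K →+* Module.End k V, (∀ c : k, ∃ a, ρ a = algebraMap k _ c) ∧
      (∀ X ∈ D, ∀ v ∈ X, v ≠ 0 → ∀ w, w ∈ X ↔ ∃ a, ρ a v = w) := by
  obtain ⟨B, hB, hBn, rfl⟩ := hD
  let _ : Field B := hB.toField
  have : Module.Finite k B := Module.finite_of_finrank_pos (hBn ▸ Nat.pos_of_ne_zero hn)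
  have : Finite B := Module.finite_of_finite k
  have := Fintype.ofFinite K
  have := Fintype.ofFinite B
  have hc : Fintype.card K = Fintype.card B := by
    rw [← Nat.card_eq_fintype_card, ← Nat.card_eq_fintype_card, hcard, ← hBn]
    exact (Module.natCard_eq_pow_finrank (K := k) (V := B)).symm
  let ψ : K ≃+* B := FiniteField.ringEquivOfCardEq hc
  refine ⟨B.subtype.comp ψ.toRingHom, fun c => ⟨ψ.symm (algebraMap k B c), ?_⟩, ?_⟩
  · change ((ψ (ψ.symm (algebraMap k B c)) : B) : Module.End k V) = _
    rw [RingEquiv.apply_symm_apply]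
    rfl
  · rintro X ⟨v₀, -, hX⟩ v hv hv0 w
    have hX' (w : V) : w ∈ X ↔ ∃ a : K, (ψ a : Module.End k V) v₀ = w := by
      rw [← SetLike.mem_coe, hX]
      constructor
      · rintro ⟨b, hb, rfl⟩
        exact ⟨ψ.symm ⟨b, hb⟩, by rw [RingEquiv.apply_symm_apply]⟩
      · rintro ⟨a, rfl⟩
        exact ⟨_, (ψ a).2, rfl⟩
    obtain ⟨a, rfl⟩ := (hX' v).mp hv
    have ha : a ≠ 0 := by
      rintro rfl
      simp at hv0
    rw [hX']
    change _ ↔ ∃ b : K, (ψ b : Module.End k V) ((ψ a : Module.End k V) v₀) = w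
    constructor
    · rintro ⟨b, rfl⟩
      refine ⟨b * a⁻¹, ?_⟩
      rw [← Module.End.mul_apply, ← Subalgebra.coe_mul, ← map_mul, inv_mul_cancel_right₀ ha]
    · rintro ⟨b, rfl⟩
      exact ⟨b * a, by rw [map_mul, Subalgebra.coe_mul, Module.End.mul_apply]⟩

theorem exists_card_rightSpan_le_of_BELSpread {n r : ℕ} (hn : Module.finrank k R = n)
    (hcard : Nat.card K = Nat.card R)
    {D : Set (Submodule k (Fin (r * n) → k))}
    {U W : Submodule k (Fin (r * n) → k)}
    (hconf : IsBELConfiguration k n r D U W)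
    {𝒯 : Set (Submodule k
      (Ambient k n r ⧸ (embed W : Submodule k (Ambient k n r))))}
    (h𝒯 : IsBELSpread k n r D U W 𝒯)
    (heq : SpreadEquiv 𝒯 (semifieldSpread k R)) :
    ∃ θ : K →+ R, Function.Bijective θ ∧ Nat.card (rightSpan θ) ≤ Nat.card R ^ r := by
  have hfink : Finite k := Finite.of_injective (fun c : k => c • (1 : R))
    (smul_left_injective k one_ne_zero)
  have hfinR : Module.Finite k R := Module.Finite.of_finite
  have hn0 : n ≠ 0 := hn ▸ Module.finrank_pos.ne'
  have hcardR : Nat.card R = Nat.card k ^ n := hn ▸ Module.natCard_eq_pow_finrank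
  obtain ⟨D', A, hD', hDD', hAn, hAU, rfl⟩ := h𝒯
  -- Only additivity of the equivalence is needed, since an additive θ is enough.
  obtain ⟨σ, φ, -, himg⟩ := heq
  obtain ⟨ρ, hρk, hρ⟩ := exists_ringHom_of_isDesarguesianSpread hn0 (hcard.trans hcardR) hD'
  let _ : Module K (Ambient k n r) := Module.compHom _ ρ
  have hsmul (a : K) (v : Ambient k n r) : a • v = ρ a v := rfl
  have hembed (X : Submodule k (Fin (r * n) → k)) (v) (w) :
      ((v, w) : Ambient k n r) ∈ (embed X : Submodule k (Ambient k n r)) ↔ v ∈ X ∧ w = 0 := by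
    constructor
    · rintro ⟨v, hv, h⟩
      obtain ⟨rfl, rfl⟩ := Prod.mk.inj h
      exact ⟨hv, rfl⟩
    · rintro ⟨hv, rfl⟩
      exact ⟨v, hv, rfl⟩
  have hinl (X) (hX : X ∈ D) (u) (hu : u ∈ X) (a : K) :
      ∃ w ∈ X, a • ((u, 0) : Ambient k n r) = (w, 0) := by
    rcases eq_or_ne u 0 with rfl | hu0
    · exact ⟨0, X.zero_mem, by rw [Prod.mk_zero_zero, smul_zero]⟩
    have h1 := (hρ _ (hDD' X hX) (u, 0) ((hembed _ _ _).mpr ⟨hu, rfl⟩)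
      (fun h => hu0 (congrArg Prod.fst h)) (a • ((u, 0) : Ambient k n r))).mpr ⟨a, rfl⟩
    obtain ⟨w, hw, h⟩ := h1
    exact ⟨w, hw, h.symm⟩
  have hUW (u) (hu : u ∈ U) (hu0 : u ≠ 0) (a : K) (w) (hw : w ∈ W)
      (ha : a • ((u, 0) : Ambient k n r) = (w, 0)) : a = 0 := by
    by_contra ha0
    obtain ⟨X, hX, huX⟩ := mem_of_mem_desarguesianSpread hconf.desarguesian hu0
    obtain ⟨w', hw', h⟩ := hinl X hX u huX a
    obtain rfl : w = w' := congrArg Prod.fst (ha.symm.trans h)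
    refine hconf.not_both X hX ⟨(Submodule.ne_bot_iff _).mpr ⟨u, ⟨huX, hu⟩, hu0⟩,
      (Submodule.ne_bot_iff _).mpr ⟨w, ⟨hw', hw⟩, ?_⟩⟩
    rintro rfl
    rw [Prod.mk_zero_zero, smul_eq_zero] at ha
    exact hu0 (congrArg Prod.fst (ha.resolve_left ha0))
  -- The copy of V(rn, k) is K-stable because it is covered by elements of D, which remain elements
  -- of D'.
  let E₀ : Submodule K (Ambient k n r) :=
    { carrier := {v | v.2 = 0}
      zero_mem' := rfl
      add_mem' := fun {v w} hv hw => by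
        change v.2 + w.2 = 0
        rw [hv, hw, add_zero]
      smul_mem' := fun a v (hv : v.2 = 0) => by
        obtain ⟨u, w⟩ := v
        obtain rfl : w = 0 := hv
        rcases eq_or_ne u 0 with rfl | hu0
        · rw [Prod.mk_zero_zero, smul_zero]
          rfl
        obtain ⟨X, hX, huX⟩ := mem_of_mem_desarguesianSpread hconf.desarguesian hu0
        obtain ⟨w, -, h⟩ := hinl X hX u huX a
        rw [h]
        rfl }
  have hE₀ (v : Ambient k n r) : v ∈ E₀ ↔ v.2 = 0 := Iff.rfl
  have hE₀card : Nat.card E₀ = Nat.card R ^ r := by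
    let e : E₀ ≃ (Fin (r * n) → k) :=
      { toFun := fun v => v.1.1
        invFun := fun v => ⟨(v, 0), rfl⟩
        left_inv := fun v => Subtype.ext (Prod.ext rfl v.2.symm)
        right_inv := fun v => rfl }
    rw [Nat.card_congr e, Nat.card_fun, Nat.card_fin, hcardR, ← pow_mul, mul_comm]
  let π := (embed W : Submodule k (Ambient k n r)).mkQ
  let Φ : Ambient k n r →+ R × R := φ.toAddMonoidHom.comp π.toAddMonoidHom
  have hΦ0 (v) : Φ v = 0 ↔ v ∈ (embed W : Submodule k (Ambient k n r)) := by
    change φ (π v) = 0 ↔ _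
    rw [map_eq_zero_iff φ φ.injective]
    exact Submodule.Quotient.mk_eq_zero _
  have himage (X : Submodule k (Ambient k n r)) (p : R × R) :
      p ∈ φ '' (X.map π : Submodule k _) ↔ ∃ v ∈ X, Φ v = p := by
    rw [Submodule.map_coe, Set.image_image]
    rfl
  have hcomp (Y : Submodule k (R × R)) (hY : Y ∈ semifieldSpread k R) :
      ∃ m ∈ A, ∀ p, (∃ a : K, Φ (a • m) = p) ↔ p ∈ Y := by
    obtain ⟨_, ⟨X, hX, hXA, rfl⟩, h⟩ := himg.symm.subset ⟨Y, hY, rfl⟩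
    obtain ⟨m, ⟨hmX, hmA⟩, hm0⟩ := Submodule.exists_mem_ne_zero_of_ne_bot hXA
    refine ⟨m, hmA, fun p => ?_⟩
    refine Iff.trans ?_ ((himage X p).symm.trans (Set.ext_iff.mp h p))
    constructor
    · rintro ⟨a, h⟩
      exact ⟨_, (hρ X hX m hmX hm0 _).mpr ⟨a, rfl⟩, h⟩
    · rintro ⟨v, hv, h⟩
      obtain ⟨a, rfl⟩ := (hρ X hX m hmX hm0 _).mp hv
      exact ⟨a, h⟩
  have hUA : (embed U : Submodule k (Ambient k n r)) ≤ A := hAU ▸ inf_le_left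
  have hUn : Module.finrank k (embed U : Submodule k (Ambient k n r)) = n :=
    ((Submodule.equivMapOfInjective _ LinearMap.inl_injective U).finrank_eq.symm).trans
      hconf.finrank_U
  suffices ∃ (θ : K →+ R) (H : Ambient k n r →+ R), Function.Bijective θ ∧ ∀ x : R,
      ∃ u ∈ (embed U : Submodule k (Ambient k n r)).toAddSubgroup, ∀ b : K,
        x * θ b = H (b • u) by
    obtain ⟨θ, H, hθ, h⟩ := this
    refine ⟨θ, hθ, (card_rightSpan_le E₀ θ H fun x => ?_).trans hE₀card.le⟩
    obtain ⟨u, hu, hx⟩ := h x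
    exact ⟨u, ((hembed _ u.1 u.2).mp hu).2, hx⟩
  refine exists_bijection_of_spread hcard E₀ Φ ?_
    (embed U : Submodule k (Ambient k n r)).toAddSubgroup ?_ ?_ A ?_ ?_ ?_ ?_
  · intro v hv
    exact ((hembed _ v.1 v.2).mp ((hΦ0 v).mp hv)).2
  · refine le_of_eq ?_
    exact (Module.natCard_eq_pow_finrank (K := k)
      (V := (embed U : Submodule k (Ambient k n r)))).trans
      ((congrArg (Nat.card k ^ ·) hUn).trans hcardR.symm)
  · intro u hu
    exact ((hembed _ u.1 u.2).mp hu).2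
  · intro m₀ hm₀ hm₀E m hm hmE
    have hm₀U : m₀ ∉ (embed U : Submodule k (Ambient k n r)) := fun h =>
      hm₀E ((hembed _ m₀.1 m₀.2).mp h).2
    -- By dimension, A is U plus the k-line of m₀, so every other point of A off E₀ can be rescaled
    -- to differ from m₀ by an element of U.
    have hsup : (embed U ⊔ k ∙ m₀ : Submodule k (Ambient k n r)) = A := by
      refine Submodule.eq_of_le_of_finrank_eq
        (sup_le hUA ((Submodule.span_singleton_le_iff_mem _ _).mpr hm₀)) ?_
      rw [Submodule.finrank_sup_span_singleton hm₀U, hUn, hAn]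
    obtain ⟨u, hu, w, hw, rfl⟩ := Submodule.mem_sup.mp (hsup.symm ▸ hm)
    obtain ⟨c, rfl⟩ := Submodule.mem_span_singleton.mp hw
    have hc : c ≠ 0 := by
      rintro rfl
      rw [zero_smul, add_zero] at hmE
      exact hmE ((hembed _ u.1 u.2).mp hu).2
    obtain ⟨a, ha⟩ := hρk c⁻¹
    refine ⟨a, ?_⟩
    rw [hsmul, ha, Module.algebraMap_end_apply, smul_add, inv_smul_smul₀ hc, add_sub_cancel_right]
    exact Submodule.smul_mem _ _ hu
  · obtain ⟨u, hu, hu0⟩ := Submodule.exists_mem_ne_zero_of_ne_bot (p := U) (by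
      rintro rfl
      exact hn0 (hconf.finrank_U.symm.trans (finrank_bot k _)))
    obtain ⟨X, hX, huX⟩ := mem_of_mem_desarguesianSpread hconf.desarguesian hu0
    have hu0' : ((u, 0) : Ambient k n r) ≠ 0 := fun h => hu0 (congrArg Prod.fst h)
    have huX' : ((u, 0) : Ambient k n r) ∈ (embed X : Submodule k (Ambient k n r)) :=
      (hembed _ _ _).mpr ⟨huX, rfl⟩
    obtain ⟨Y, hY, hYX⟩ := himg.subset ⟨_, ⟨_, hDD' X hX, (Submodule.ne_bot_iff _).mpr
      ⟨_, ⟨huX', hUA ((hembed _ _ _).mpr ⟨hu, rfl⟩)⟩, hu0'⟩, rfl⟩, rfl⟩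
    -- The K-line of a nonzero u in U meets W trivially, so by counting it is a complement of W.
    -- Hence all of E₀ maps into the single spread element Y.
    let f : K × W →+ (Fin (r * n) → k) :=
      { toFun := fun p => (p.1 • ((u, 0) : Ambient k n r)).1 + p.2
        map_zero' := by simp
        map_add' := fun p q => by
          simp only [Prod.fst_add, Prod.snd_add, add_smul, Submodule.coe_add]
          abel }
    have hfinj : Function.Injective f := by
      refine (injective_iff_map_eq_zero f).mpr ?_
      rintro ⟨a, w⟩ h
      have h1 : (a • ((u, 0) : Ambient k n r)).1 = -w := eq_neg_of_add_eq_zero_left h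
      have h2 : a = 0 := hUW u hu hu0 a _ (W.neg_mem w.2) (Prod.ext h1
        (E₀.smul_mem a (x := ((u, 0) : Ambient k n r)) rfl))
      subst h2
      rw [zero_smul] at h1
      exact Prod.ext rfl (Subtype.ext (neg_eq_zero.mp h1.symm))
    have hfsurj : Function.Surjective f := by
      refine ((Nat.bijective_iff_injective_and_card f).mpr ⟨hfinj, ?_⟩).2
      rw [Nat.card_prod, hcard, hcardR, Module.natCard_eq_pow_finrank (K := k) (V := W), ← pow_add,
        add_comm, hconf.finrank_W, Nat.card_fun, Nat.card_fin]
    have hE₀Y (v) (hv : v ∈ E₀) : Φ v ∈ Y := by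
      obtain ⟨⟨a, w⟩, h⟩ := hfsurj v.1
      have hv' : v = a • ((u, 0) : Ambient k n r) + ((w : Fin (r * n) → k), 0) := by
        refine Prod.ext h.symm (((hE₀ v).mp hv).trans ?_)
        rw [Prod.snd_add, (hE₀ _).mp (E₀.smul_mem a (x := ((u, 0) : Ambient k n r)) rfl), add_zero]
      rw [hv', map_add, (hΦ0 _).mpr ((hembed _ _ _).mpr ⟨w.2, rfl⟩), add_zero]
      exact hYX.symm.subset ((himage _ _).mpr
        ⟨_, (hρ _ (hDD' X hX) _ huX' hu0' _).mpr ⟨a, rfl⟩, rfl⟩)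
    rcases hY with ⟨x, hx⟩ | hY
    · exact Or.inl ⟨x, fun v hv => hx.subset (hE₀Y v hv)⟩
    · exact Or.inr fun v hv => hY.subset (hE₀Y v hv)
  · intro x
    exact hcomp (graphSubmodule k x) (Or.inl ⟨x, rfl⟩)
  · exact hcomp (LinearMap.ker (LinearMap.fst k R R)) (Or.inr rfl)

end Lower

/-! ### Spreads of endomorphisms -/

theorem card_rightSpan_le_of_action {k K R M : Type*} [Field k] [Field K] [NonAssocRing R]
    [AddCommGroup M] [Module k M] (ρ : K →+* Module.End k M) (X : Submodule k M) [Finite X]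
    (hX : ∀ a, ∀ v ∈ X, ρ a v ∈ X) (θ : K →+ R) (H : M →+ R)
    (h : ∀ x : R, ∃ v ∈ X, ∀ b : K, x * θ b = H (ρ b v)) :
    Nat.card (rightSpan θ) ≤ Nat.card X := by
  let _ : Module K M := Module.compHom M ρ
  let X' : Submodule K M := { X with smul_mem' := hX }
  have : Finite X' := ‹Finite X›
  exact card_rightSpan_le X' θ H h

theorem spanB_stable {k V : Type*} [Field k] [AddCommGroup V] [Module k V]
    {D : Set (Submodule k V)} {L : Set V} (T : V →ₗ[k] V) (hT : ∀ X ∈ D, ∀ v ∈ X, T v ∈ X)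
    {v : V} (hv : v ∈ spanB D L) : T v ∈ spanB D L := by
  have : spanB D L ≤ (spanB D L).comap T :=
    sSup_le fun X hX w hw => le_sSup hX (hT X hX.1 w hw)
  exact this hv

theorem mem_spanB {k V : Type*} [Field k] [AddCommGroup V] [Module k V]
    {D : Set (Submodule k V)} {L : Set V} {X : Submodule k V} (hX : X ∈ D) {v : V} (hvX : v ∈ X)
    (hvL : v ∈ L) : v ∈ spanB D L := by
  rcases eq_or_ne v 0 with rfl | hv
  · exact zero_mem _
  · exact (le_sSup ⟨hX, v, hvL, hv, hvX⟩ : X ≤ spanB D L) hvX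

section Endomorphisms

variable {F K : Type*} [Field F] [Field K] [Algebra F K]

/-- The action of `K` on `End_F(K)` by precomposition with multiplications, conjugated by `θ`. -/
def precompAction (θ : K ≃ₗ[F] K) : K →ₐ[F] Module.End F (Module.End F K) :=
  AlgHom.ofLinearMap
    { toFun := fun a =>
        { toFun := fun f => f ∘ₗ θ.toLinearMap ∘ₗ LinearMap.mulLeft F a ∘ₗ θ.symm.toLinearMap
          map_add' := fun _ _ => rfl
          map_smul' := fun _ _ => rfl }
      map_add' := fun a b => by
        ext f x
        simp [add_mul]
      map_smul' := fun c a => by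
        ext f x
        simp }
    (by
      ext f x
      simp)
    (fun a b => by
      ext f x
      simp [mul_left_comm a b])

theorem precompAction_apply (θ : K ≃ₗ[F] K) (a : K) (f : Module.End F K) (x : K) :
    precompAction θ a f x = f (θ (a * θ.symm x)) := rfl

theorem Dr_eq_lines : Dr F K = lines (precompAction (LinearEquiv.refl F K)) := by
  ext X
  simp only [Dr, lines, Set.mem_ofPred_eq]
  refine exists_congr fun f => and_congr_right fun _ => ?_
  have : {g | ∃ a : K, g = f ∘ₗ LinearMap.mulLeft F a} =
      {g | ∃ a, precompAction (LinearEquiv.refl F K) a f = g} := by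
    ext g
    exact exists_congr fun a => eq_comm
  rw [this]

theorem lines_stable {V : Type*} [AddCommGroup V] [Module F V] (ρ : K →ₐ[F] Module.End F V)
    {X : Submodule F V} (hX : X ∈ lines ρ) (a : K) {v : V} (hv : v ∈ X) : ρ a v ∈ X := by
  obtain ⟨w, -, rfl⟩ := mem_lines.mp hX
  obtain ⟨b, rfl⟩ := mem_line.mp hv
  exact mem_line.mpr ⟨a * b, by rw [map_mul, Module.End.mul_apply]⟩

/-- Precomposition does not enlarge images, so the K-line of a rank one map lies in the
corresponding member of F_r; both have dimension n. -/
theorem Fr_subset_lines [Finite K] (θ : K ≃ₗ[F] K) : Fr F K ⊆ lines (precompAction θ) := by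
  rintro X ⟨c, hc, hX⟩
  have hX' (f : Module.End F K) : f ∈ X ↔ LinearMap.range f ≤ F ∙ c := by
    rw [← SetLike.mem_coe, hX]
    rfl
  have : Module.Finite F K := Module.Finite.of_finite
  obtain ⟨φ, hφ⟩ := Module.Projective.exists_dual_ne_zero F (one_ne_zero (α := K))
  have hφ0 : φ.smulRight c ≠ 0 := fun h => by
    have := LinearMap.congr_fun h 1
    simp [hφ, hc] at this
  refine mem_lines.mpr ⟨φ.smulRight c, hφ0, ?_⟩
  symm
  refine Submodule.eq_of_le_of_finrank_le ?_ ?_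
  · intro f hf
    obtain ⟨a, rfl⟩ := mem_line.mp hf
    rw [hX']
    rintro _ ⟨x, rfl⟩
    exact Submodule.smul_mem _ _ (Submodule.mem_span_singleton_self c)
  · have h1 : X ≤ LinearMap.range ((LinearMap.smulRightₗ : (K →ₗ[F] F) →ₗ[F] K →ₗ[F] K →ₗ[F] K).flip
        c) := by
      intro f hf
      have hf' (x : K) : ∃ a : F, a • c = f x :=
        Submodule.mem_span_singleton.mp ((hX' f).mp hf ⟨x, rfl⟩)
      choose g hg using hf'
      have hinj : Function.Injective fun a : F => a • c := smul_left_injective F hc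
      refine ⟨{ toFun := g, map_add' := fun x y => hinj ?_, map_smul' := fun a x => hinj ?_ }, ?_⟩
      · simp [add_smul, hg]
      · simp [mul_smul, hg]
      · ext x
        exact hg x
    calc Module.finrank F X ≤ _ := Submodule.finrank_mono h1
      _ ≤ Module.finrank F (K →ₗ[F] F) := LinearMap.finrank_range_le _
      _ = Module.finrank F K := Subspace.dual_finrank_eq
      _ = _ := by
        refine (LinearMap.finrank_range_of_inj ?_).symm
        refine (injective_iff_map_eq_zero ((LinearMap.applyₗ (φ.smulRight c)).comp
          (precompAction θ).toLinearMap)).mpr fun a ha => ?_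
        by_contra ha0
        refine hφ0 ?_
        have h2 : precompAction θ a (φ.smulRight c) = 0 := ha
        have h3 := congrArg (precompAction θ a⁻¹) h2
        rwa [map_zero, ← Module.End.mul_apply, ← map_mul, inv_mul_cancel₀ ha0, map_one] at h3

/-- A field action on `End_F(K)` that stabilizes the spaces of maps with image in a given line is
an action by precomposition. -/
theorem apply_eq_comp_of_stable [Finite K] (T : Module.End F K →ₗ[F] Module.End F K)
    (hT : ∀ X ∈ Fr F K, ∀ f ∈ X, T f ∈ X) (f : Module.End F K) : T f = f ∘ₗ T LinearMap.id := by
  have : Module.Finite F K := Module.Finite.of_finite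
  -- The map c ↦ T (φ ⊗ c) x has every nonzero vector as an eigenvector, so it is a scalar. Thus T
  -- acts only on the functional in a rank one map, and rank one maps span E.
  have hscal (φ : K →ₗ[F] F) (x : K) : ∃ s : F, ∀ c : K, T (φ.smulRight c) x = s • c := by
    let g : K →ₗ[F] K := LinearMap.applyₗ x ∘ₗ T ∘ₗ
      (LinearMap.smulRightₗ : (K →ₗ[F] F) →ₗ[F] K →ₗ[F] K →ₗ[F] K) φ
    obtain ⟨s, hs⟩ := LinearMap.exists_eq_smul_id_of_forall_notLinearIndependent (f := g) (by
      intro c hli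
      have hc : c ≠ 0 := hli.ne_zero 0
      let X : Submodule F (Module.End F K) :=
        { carrier := {f | LinearMap.range f ≤ F ∙ c}
          zero_mem' := by simp
          add_mem' := fun {f g} hf hg => (LinearMap.range_add_le f g).trans (sup_le hf hg)
          smul_mem' := fun a f hf => by
            rintro _ ⟨x, rfl⟩
            exact Submodule.smul_mem _ a (hf ⟨x, rfl⟩) }
      have hX := hT X ⟨c, hc, rfl⟩ (φ.smulRight c) (by
        rintro _ ⟨x, rfl⟩
        exact Submodule.smul_mem _ _ (Submodule.mem_span_singleton_self c))
      obtain ⟨a, ha⟩ := Submodule.mem_span_singleton.mp (hX ⟨x, rfl⟩)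
      have := LinearIndependent.pair_iff.mp hli a (-1) (by
        rw [neg_one_smul]
        exact add_neg_eq_zero.mpr ha)
      exact one_ne_zero (neg_eq_zero.mp this.2))
    exact ⟨s, fun c => LinearMap.congr_fun hs c⟩
  let b := Module.finBasis F K
  have hid : (LinearMap.id : K →ₗ[F] K) = ∑ i, (b.coord i).smulRight (b i) := by
    ext x
    simp [LinearMap.sum_apply, b.sum_repr]
  have hf : f = ∑ i, (b.coord i).smulRight (f (b i)) := by
    ext x
    conv_lhs => rw [← b.sum_repr x, map_sum]
    simp [LinearMap.sum_apply]
  ext x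
  conv_lhs => rw [hf]
  rw [hid]
  simp only [map_sum, LinearMap.comp_apply, LinearMap.sum_apply]
  refine Finset.sum_congr rfl fun i _ => ?_
  obtain ⟨s, hs⟩ := hscal (b.coord i) x
  rw [hs, hs, map_smul]

end Endomorphisms

/-! ### Comparing the spans in E with right spans -/

namespace SemifieldOn

variable {F K : Type*} [Field F] [Field K] [Algebra F K]

instance (S : SemifieldOn F K) : Module F S.Carrier := inferInstanceAs (Module F K)

instance (S : SemifieldOn F K) : IsScalarTower F S.Carrier S.Carrier :=
  ⟨fun c x y => LinearMap.congr_fun (S.mul.map_smul c x) y⟩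

instance (S : SemifieldOn F K) : SMulCommClass F S.Carrier S.Carrier :=
  ⟨fun c x y => ((S.mul x).map_smul c y).symm⟩

variable [Finite K] (S : SemifieldOn F K)

/-- Take θ = Q⁻¹: then x * θ b is H⁻¹ applied to the value at 1 of left multiplication by P x in S',
precomposed with b. -/
theorem exists_card_rightSpan_le_of_isotopic {S' : SemifieldOn F K} (h : S.Isotopic S') :
    ∃ θ : K →+ S.Carrier, Function.Bijective θ ∧
      Nat.card (rightSpan θ) ≤ Nat.card (spanB (Dr F K) S'.leftSpreadSet) := by
  obtain ⟨P, Q, H, h⟩ := h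
  have : Finite (Module.End F K) := DFunLike.finite _
  refine ⟨(Q.symm.toLinearMap.toAddMonoidHom : K →+ K), Q.symm.bijective, ?_⟩
  let ρ := precompAction (LinearEquiv.refl F K)
  have hDr : Dr F K = lines ρ := Dr_eq_lines
  refine card_rightSpan_le_of_action ρ.toRingHom _ (fun a v hv => spanB_stable (ρ a)
    (fun X hX v hv => lines_stable ρ (hDr ▸ hX) a hv) hv) _
    ((H.symm.toLinearMap ∘ₗ LinearMap.applyₗ (1 : K)).toAddMonoidHom : Module.End F K →+ K)
    fun x => ⟨S'.mul (P x), ?_, fun b => ?_⟩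
  · by_cases h0 : S'.mul (P x) = 0
    · rw [h0]
      exact zero_mem _
    · exact mem_spanB (X := line ρ (S'.mul (P x)))
        (hDr ▸ mem_lines.mpr ⟨_, h0, rfl⟩) (self_mem_line _ _) ⟨_, rfl⟩
  · change S.mul x (Q.symm b) = H.symm (S'.mul (P x) (b * 1))
    rw [_root_.mul_one, LinearEquiv.eq_symm_apply]
    exact (h x _).symm.trans (congrArg _ (Q.apply_symm_apply b))

theorem exists_card_rightSpan_le_of_Fr_subset {D : Set (Submodule F (Module.End F K))}
    (hD : IsDesarguesianSpread F (Module.End F K) (Module.finrank F K) D) (hFr : Fr F K ⊆ D) :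
    ∃ θ : K →+ S.Carrier, Function.Bijective θ ∧
      Nat.card (rightSpan θ) ≤ Nat.card (spanB D S.leftSpreadSet) := by
  have : Module.Finite F K := Module.Finite.of_finite
  have : Finite F := Finite.of_injective _ (algebraMap F K).injective
  have : Finite (Module.End F K) := DFunLike.finite _
  obtain ⟨ρ, -, hρ⟩ := exists_ringHom_of_isDesarguesianSpread (K := K)
    Module.finrank_pos.ne' Module.natCard_eq_pow_finrank hD
  have hstab (X) (hX : X ∈ D) (a : K) (f) (hf : f ∈ X) : ρ a f ∈ X := by
    rcases eq_or_ne f 0 with rfl | hf0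
    · rw [map_zero]
      exact X.zero_mem
    · exact (hρ X hX f hf hf0 _).mpr ⟨a, rfl⟩
  have hcomp (a : K) (f) : ρ a f = f ∘ₗ ρ a LinearMap.id :=
    apply_eq_comp_of_stable (ρ a) (fun X hX => hstab X (hFr hX) a) f
  let θ : K →+ S.Carrier :=
    (AddMonoidHom.mk' (fun a => ρ a LinearMap.id 1) fun a b => by simp : K →+ K)
  have hθinj : Function.Injective θ := by
    refine (injective_iff_map_eq_zero θ).mpr fun a ha => ?_
    by_contra ha0
    -- By the precomposition formula, the image of the identity under ρ a has a left inverse, so it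
    -- cannot kill 1.
    have h1 : ρ a (ρ a⁻¹ LinearMap.id) = LinearMap.id := by
      rw [← Module.End.mul_apply, ← map_mul, mul_inv_cancel₀ ha0, map_one, Module.End.one_apply]
    rw [hcomp] at h1
    have h2 := LinearMap.congr_fun h1 1
    have h3 : ρ a LinearMap.id 1 = 0 := ha
    rw [LinearMap.comp_apply, h3, map_zero] at h2
    exact zero_ne_one h2
  refine ⟨θ, (Nat.bijective_iff_injective_and_card θ).mpr ⟨hθinj, rfl⟩, ?_⟩
  refine card_rightSpan_le_of_action ρ _ (fun a v hv => spanB_stable (ρ a)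
    (fun X hX v hv => hstab X hX a v hv) hv) _
    ((LinearMap.applyₗ (1 : K)).toAddMonoidHom : Module.End F K →+ K)
    fun x => ⟨S.mul x, ?_, fun b => ?_⟩
  · rcases eq_or_ne (S.mul x) 0 with h0 | h0
    · rw [h0]
      exact zero_mem _
    · obtain ⟨X, hX, hxX⟩ := mem_of_mem_desarguesianSpread hD h0
      exact mem_spanB hX hxX ⟨x, rfl⟩
  · change S.mul x (ρ b LinearMap.id 1) = ρ b (S.mul x) 1
    rw [hcomp b (S.mul x), LinearMap.comp_apply]

theorem card_spanB_le (θ : K →+ S.Carrier) (D : Set (Submodule F (Module.End F K)))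
    (L : Set (Module.End F K)) (J : Module.End F K →+ DomHom K S.Carrier)
    (hJ : Function.Injective J) (hsmul : ∀ (c : F) f, J (c • f) = algebraMap F K c • J f)
    (h : ∀ X ∈ D, ∀ f ∈ L, f ≠ 0 → f ∈ X → ∀ g ∈ X, J g ∈ rightSpan θ) :
    Nat.card (spanB D L) ≤ Nat.card (rightSpan θ) := by
  let Y : Submodule F (Module.End F K) :=
    { carrier := {f | J f ∈ rightSpan θ}
      zero_mem' := by
        rw [Set.mem_ofPred_eq, map_zero]
        exact zero_mem _
      add_mem' := fun {f g} hf hg => by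
        rw [Set.mem_ofPred_eq, map_add]
        exact add_mem hf hg
      smul_mem' := fun c f hf => by
        rw [Set.mem_ofPred_eq, hsmul]
        exact Submodule.smul_mem _ _ hf }
  have hle : spanB D L ≤ Y := by
    refine sSup_le ?_
    rintro X ⟨hX, f, hf, hf0, hfX⟩
    exact h X hX f hf hf0 hfX
  exact Nat.card_le_card_of_injective (fun f => (⟨J f, hle f.2⟩ : rightSpan θ))
    fun f g hfg => Subtype.ext (hJ (congrArg Subtype.val hfg))

/-- Transport the multiplication by θ in all three places. Composing with θ on the left then carries
each left multiplication of S' to a generator of the right span. -/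
theorem exists_isotopic_card_spanB_le (θ : K ≃ₗ[F] K) :
    ∃ S' : SemifieldOn F K, S.Isotopic S' ∧ Nat.card (spanB (Dr F K) S'.leftSpreadSet) ≤
      Nat.card (rightSpan (R := S.Carrier) (θ.toLinearMap.toAddMonoidHom : K →+ K)) := by
  let S' : SemifieldOn F K :=
    { mul := (S.mul.compl₁₂ θ.toLinearMap θ.toLinearMap).compr₂ θ.symm.toLinearMap
      one := θ.symm S.one
      one_mul := fun x => by simp [S.one_mul]
      mul_one := fun x => by simp [S.mul_one]
      eq_zero_or_eq_zero := fun x y h => by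
        simpa using S.eq_zero_or_eq_zero (θ x) (θ y) (by simpa using h) }
  have hS' (x y : K) : S'.mul x y = θ.symm (S.mul (θ x) (θ y)) := rfl
  refine ⟨S', ⟨θ.symm, θ.symm, θ.symm, fun x y => by simp [hS']⟩, ?_⟩
  let J : Module.End F K →+ DomHom K S.Carrier :=
    { toFun := fun f => DomHom.of ((θ.toLinearMap ∘ₗ f).toAddMonoidHom : K →+ K)
      map_zero' := DomHom.ext fun _ => θ.map_zero
      map_add' := fun f g => DomHom.ext fun _ => θ.map_add _ _ }
  have hJ (f : Module.End F K) (x : K) : J f x = θ (f x) := rfl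
  refine card_spanB_le S _ _ _ J ?_ ?_ ?_
  · intro f g h
    ext x
    exact θ.injective (DFunLike.congr_fun h x)
  · intro c f
    refine DomHom.ext fun x => ?_
    rw [DomHom.smul_apply, hJ, hJ, ← Algebra.smul_def, f.map_smul]
    rfl
  · rintro X hX _ ⟨x, rfl⟩ hf0 hfX g hg
    rw [Dr_eq_lines] at hX
    obtain ⟨v, -, rfl⟩ := mem_lines.mp hX
    rw [line_eq_of_mem hf0 hfX] at hg
    obtain ⟨a, rfl⟩ := mem_line.mp hg
    have : J (precompAction (LinearEquiv.refl F K) a (S'.mul x)) =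
        a • DomHom.of ((AddMonoidHom.mulLeft (R := S.Carrier) (θ x)).comp
          (θ.toLinearMap.toAddMonoidHom : K →+ K)) := DomHom.ext fun y => by
      rw [hJ, precompAction_apply, hS']
      exact θ.apply_symm_apply _
    rw [this]
    exact Submodule.smul_mem _ _ (mulLeft_comp_mem_rightSpan _ _)

/-- Here the spread is conjugated and the semifield kept: composing with θ on the right turns the
conjugated action into plain precomposition. -/
theorem card_spanB_lines_le (θ : K ≃ₗ[F] K) :
    Nat.card (spanB (lines (precompAction θ)) S.leftSpreadSet) ≤
      Nat.card (rightSpan (R := S.Carrier) (θ.toLinearMap.toAddMonoidHom : K →+ K)) := by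
  let J : Module.End F K →+ DomHom K S.Carrier :=
    { toFun := fun f => DomHom.of ((f ∘ₗ θ.toLinearMap).toAddMonoidHom : K →+ K)
      map_zero' := rfl
      map_add' := fun f g => rfl }
  have hJ (f : Module.End F K) (x : K) : J f x = f (θ x) := rfl
  refine card_spanB_le S _ _ _ J ?_ ?_ ?_
  · intro f g h
    ext x
    have hx : f (θ (θ.symm x)) = g (θ (θ.symm x)) := DFunLike.congr_fun h (θ.symm x)
    rwa [θ.apply_symm_apply] at hx
  · intro c f
    refine DomHom.ext fun x => ?_
    rw [DomHom.smul_apply, hJ, hJ, ← Algebra.smul_def, θ.map_smul, f.map_smul]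
    rfl
  · rintro X hX _ ⟨x, rfl⟩ hf0 hfX g hg
    obtain ⟨v, -, rfl⟩ := mem_lines.mp hX
    rw [line_eq_of_mem hf0 hfX] at hg
    obtain ⟨a, rfl⟩ := mem_line.mp hg
    have : J (precompAction θ a (S.mul x)) =
        a • DomHom.of ((AddMonoidHom.mulLeft (R := S.Carrier) x).comp
          (θ.toLinearMap.toAddMonoidHom : K →+ K)) := DomHom.ext fun y => by
      rw [hJ, precompAction_apply, LinearEquiv.symm_apply_apply]
      rfl
    rw [this]
    exact Submodule.smul_mem _ _ (mulLeft_comp_mem_rightSpan _ _)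

end SemifieldOn

/-! ### The BEL-rank over a field acting on a semifield -/

/-- Some bijection that is linear over `Z` minimizes the span of the left multiplications among all
additive bijections. -/
theorem exists_minimal_bijection {Z K R : Type*} [Field Z] [Field K] [Finite K] [Algebra Z K]
    [NonAssocRing R] [Finite R] [Module Z R] [IsScalarTower Z R R] [SMulCommClass Z R R]
    (hcard : Nat.card K = Nat.card R) :
    ∃ θ : K →ₗ[Z] R, Function.Bijective θ ∧ ∀ θ' : K →+ R, Function.Bijective θ' →
      Nat.card (rightSpan θ.toAddMonoidHom) ≤ Nat.card (rightSpan θ') := by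
  have : Finite Z := Finite.of_injective _ (algebraMap Z K).injective
  obtain ⟨p, hp⟩ := CharP.exists Z
  have : Fact p.Prime := ⟨CharP.char_is_prime Z p⟩
  -- Additive maps are linear over the prime field, so descent from it covers every θ.
  let _ : Algebra (ZMod p) Z := ZMod.algebra Z p
  let _ : Algebra (ZMod p) K := ((algebraMap Z K).comp (algebraMap (ZMod p) Z)).toAlgebra
  let _ : Module (ZMod p) R := Module.compHom R (algebraMap (ZMod p) Z)
  have : IsScalarTower (ZMod p) Z K := IsScalarTower.of_algebraMap_eq fun _ => rfl
  have : IsScalarTower (ZMod p) Z R := ⟨fun c z x => by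
    rw [Algebra.smul_def, mul_smul]
    rfl⟩
  have hex : ∃ m : ℕ, ∃ θ : K →+ R, Function.Bijective θ ∧ Nat.card (rightSpan θ) = m := by
    have h1 : Nonempty (K ≃ₗ[Z] R) := by
      have : Module.Finite Z R := Module.Finite.of_finite
      have : Module.Finite Z K := Module.Finite.of_finite
      refine ⟨LinearEquiv.ofFinrankEq K R ?_⟩
      refine Nat.pow_right_injective (Finite.one_lt_card (α := Z)) ?_
      beta_reduce
      rw [← Module.natCard_eq_pow_finrank, ← Module.natCard_eq_pow_finrank, hcard]
    obtain ⟨e⟩ := h1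
    exact ⟨_, e.toLinearMap.toAddMonoidHom, e.bijective, rfl⟩
  classical
  obtain ⟨θ, hθ, hm⟩ := Nat.find_spec hex
  obtain ⟨θ₀, hθ₀, hle⟩ := exists_linear_card_rightSpan_le (Z := Z) (θ.toZModLinearMap p) hθ
  exact ⟨θ₀, hθ₀, fun θ' hθ' => hle.trans (hm.le.trans (Nat.find_le ⟨θ', hθ', rfl⟩))⟩

theorem isLeast_and_spreadBELRank {F K Z : Type*} [Field F] [Field K] [Finite K] [Algebra F K]
    (S : SemifieldOn F K) [Field Z] [Algebra F Z] [Module Z S.Carrier]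
    [IsScalarTower F Z S.Carrier] [IsScalarTower Z S.Carrier S.Carrier]
    [SMulCommClass Z S.Carrier S.Carrier] :
    ∃ d : ℕ,
      IsLeast {m : ℕ | ∃ S' : SemifieldOn F K, S.Isotopic S' ∧
        m = Module.finrank F (spanB (Dr F K) S'.leftSpreadSet)} d ∧
      IsLeast {m : ℕ | ∃ D : Set (Submodule F (Module.End F K)),
        IsDesarguesianSpread F (Module.End F K) (Module.finrank F K) D ∧ Fr F K ⊆ D ∧
        m = Module.finrank F (spanB D S.leftSpreadSet)} d ∧
      (spreadBELRank (Module.finrank Z S.Carrier) (semifieldSpread Z S.Carrier) : ℚ) =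
        1 / (Module.finrank F K : ℚ) * (d : ℚ) := by
  have hcard : Nat.card K = Nat.card S.Carrier := rfl
  have hfinF : Finite F := Finite.of_injective _ (algebraMap F K).injective
  have hfinFK : Module.Finite F K := Module.Finite.of_finite
  have hfinE : Finite (Module.End F K) := DFunLike.finite _
  have hfinZ : Finite Z := Finite.of_injective (fun c : Z => c • (1 : S.Carrier))
    (smul_left_injective Z one_ne_zero)
  have hfinFZ : Module.Finite F Z := Module.Finite.of_finite
  have hfinZS : Module.Finite Z S.Carrier := Module.Finite.of_finite
  -- Z need not lie in K a priori; it embeds over F because its degree divides that of K.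
  obtain ⟨ι⟩ : Nonempty (Z →ₐ[F] K) := FiniteField.nonempty_algHom_of_finrank_dvd
    ⟨Module.finrank Z S.Carrier, (Module.finrank_mul_finrank F Z S.Carrier).symm⟩
  let _ : Algebra Z K := ι.toRingHom.toAlgebra
  have : IsScalarTower F Z K := IsScalarTower.of_algebraMap_eq fun c => (ι.commutes c).symm
  obtain ⟨θ, hθ, hmin⟩ := exists_minimal_bijection (Z := Z) (K := K) (R := S.Carrier) hcard
  set r := Module.finrank K (rightSpan θ.toAddMonoidHom) with hr
  set n := Module.finrank F K with hn
  have hn0 : 0 < n := Module.finrank_pos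
  have hKcard : Nat.card K = Nat.card F ^ n := Module.natCard_eq_pow_finrank
  have hspan : Nat.card (rightSpan θ.toAddMonoidHom) = Nat.card K ^ r := card_rightSpan _
  have hspan' : Nat.card (rightSpan θ.toAddMonoidHom) = Nat.card F ^ (n * r) := by
    rw [hspan, hKcard, pow_mul]
  have hF1 : 1 < Nat.card F := Finite.one_lt_card
  have hlower (B : Submodule F (Module.End F K)) (θ' : K →+ S.Carrier)
      (hθ' : Function.Bijective θ') (h : Nat.card (rightSpan θ') ≤ Nat.card B) :
      n * r ≤ Module.finrank F B := by
    rw [← Nat.pow_le_pow_iff_right hF1, ← hspan',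
      ← Module.natCard_eq_pow_finrank (K := F) (V := B)]
    exact (hmin θ' hθ').trans h
  have hupper (B : Submodule F (Module.End F K))
      (h : Nat.card B ≤ Nat.card (rightSpan θ.toAddMonoidHom)) : Module.finrank F B ≤ n * r := by
    rw [← Nat.pow_le_pow_iff_right hF1, ← hspan',
      ← Module.natCard_eq_pow_finrank (K := F) (V := B)]
    exact h
  let θF : K ≃ₗ[F] K := LinearEquiv.ofBijective
    ({ toFun := fun a => (θ a : S.Carrier)
       map_add' := θ.map_add
       map_smul' := fun c a => by
        rw [← algebraMap_smul Z c a, θ.map_smul, algebraMap_smul]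
        rfl } : K →ₗ[F] K) hθ
  -- The Z-linear minimizer θ attains all three minima, and its minimality among all additive
  -- bijections gives the three lower bounds.
  refine ⟨n * r, ⟨?_, ?_⟩, ⟨?_, ?_⟩, ?_⟩
  · obtain ⟨S', hS', hle⟩ := S.exists_isotopic_card_spanB_le θF
    obtain ⟨θ', hθ', hle'⟩ := S.exists_card_rightSpan_le_of_isotopic hS'
    exact ⟨S', hS', le_antisymm (hlower _ θ' hθ' hle') (hupper _ hle)⟩
  · rintro m ⟨S', hS', rfl⟩
    obtain ⟨θ', hθ', hle'⟩ := S.exists_card_rightSpan_le_of_isotopic hS'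
    exact hlower _ θ' hθ' hle'
  · have hD := isDesarguesianSpread_lines hn.symm (precompAction θF)
    obtain ⟨θ', hθ', hle'⟩ := S.exists_card_rightSpan_le_of_Fr_subset hD (Fr_subset_lines θF)
    exact ⟨_, hD, Fr_subset_lines θF,
      le_antisymm (hlower _ θ' hθ' hle') (hupper _ (S.card_spanB_lines_le θF))⟩
  · rintro m ⟨D, hD, hFr, rfl⟩
    obtain ⟨θ', hθ', hle'⟩ := S.exists_card_rightSpan_le_of_Fr_subset hD hFr
    exact hlower _ θ' hθ' hle'
  · have hrank : spreadBELRank (Module.finrank Z S.Carrier) (semifieldSpread Z S.Carrier) = r := by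
      refine IsLeast.csInf_eq ⟨?_, ?_⟩
      · obtain ⟨G, H, hGH⟩ := exists_factorization θ
        exact exists_BELConfiguration θ hθ G H hGH
      · rintro r' ⟨D, U, W, hconf, 𝒯, h𝒯, heq⟩
        obtain ⟨θ', hθ', hle⟩ :=
          exists_card_rightSpan_le_of_BELSpread rfl hcard hconf h𝒯 heq
        have := (hmin θ' hθ').trans hle
        rw [hspan, ← hcard] at this
        exact (Nat.pow_le_pow_iff_right Finite.one_lt_card).mp this
    rw [hrank]
    have : (n : ℚ) ≠ 0 := Nat.cast_ne_zero.mpr hn0.ne'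
    push_cast
    field_simp

/-- The embedding of the ground field in the centre of a semifield. -/
def SemifieldOn.toCentre {F K : Type*} [Field F] [Field K] [Algebra F K] (S : SemifieldOn F K)
    (c : F) : Subring.center S.Carrier :=
  ⟨c • 1,
    { comm := fun a => by
        change (c • 1) * a = a * (c • 1)
        rw [smul_mul_assoc, mul_smul_comm, _root_.one_mul, _root_.mul_one]
      left_assoc := fun a b => by
        rw [smul_mul_assoc, smul_mul_assoc, smul_mul_assoc, _root_.one_mul, _root_.one_mul]
      right_assoc := fun a b => by
        rw [mul_smul_comm, mul_smul_comm, mul_smul_comm, _root_.mul_one, _root_.mul_one] }⟩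

end BEL
end

/-! ### Specialization to the full centre -/

theorem mainTheorem4 {F K : Type*} [Field F] [Field K] [Finite K] [Algebra F K]
    (S : BEL.SemifieldOn F K) :
    ∃ d : ℕ,
      IsLeast {m : ℕ | ∃ S' : BEL.SemifieldOn F K, S.Isotopic S' ∧
        m = Module.finrank F (BEL.spanB (BEL.Dr F K) S'.leftSpreadSet)} d ∧
      IsLeast {m : ℕ | ∃ D : Set (Submodule F (Module.End F K)),
        BEL.IsDesarguesianSpread F (Module.End F K) (Module.finrank F K) D ∧ BEL.Fr F K ⊆ D ∧
        m = Module.finrank F (BEL.spanB D S.leftSpreadSet)} d ∧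
      (BEL.belRank S.Carrier : ℚ) = 1 / (Module.finrank F K : ℚ) * (d : ℚ) := by
  let _ := BEL.centreField S.Carrier
  let _ := BEL.centreModule S.Carrier
  let _ : Algebra F (Subring.center S.Carrier) := RingHom.toAlgebra
    { toFun := S.toCentre
      map_one' := Subtype.ext (one_smul F _)
      map_mul' := fun a b => Subtype.ext (by
        change (a * b) • (1 : S.Carrier) = (a • 1) * (b • 1)
        rw [smul_mul_smul_comm, mul_one])
      map_zero' := Subtype.ext (zero_smul F _)
      map_add' := fun a b => Subtype.ext (add_smul a b _) }
  have hsmul (z : Subring.center S.Carrier) (x : S.Carrier) : z • x = z.1 * x := rfl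
  have : IsScalarTower F (Subring.center S.Carrier) S.Carrier := ⟨fun c z x => by
    change ((c • (1 : S.Carrier)) * z.1) * x = c • (z.1 * x)
    rw [smul_mul_assoc, one_mul, smul_mul_assoc]⟩
  have : IsScalarTower (Subring.center S.Carrier) S.Carrier S.Carrier :=
    ⟨fun z x y => (z.2.left_assoc x y).symm⟩
  have : SMulCommClass (Subring.center S.Carrier) S.Carrier S.Carrier := ⟨fun z x y => by
    change z.1 * (x * y) = x * (z.1 * y)
    rw [z.2.left_assoc, z.2.comm x, z.2.mid_assoc]⟩
  exact BEL.isLeast_and_spreadBELRank (Z := Subring.center S.Carrier) S
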